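/- Let $M$ be a connected almost Hermitian manifold of real dimension $2m\ge 6$, i.e. a connected smooth manifold with a smooth Riemannian metric $g$ and a smooth field $J$ of endomorphisms of the tangent spaces such that $J^2=-1$ and $g(JX,JY)=g(X,Y)$. Let $R(X,Y)Z=\nabla_X\nabla_YZ-\nabla_Y\nabla_XZ-\nabla_{[X,Y]}Z$ be the curvature of the Levi-Civita connection, $R(X,Y,Z,U)=g(R(X,Y)Z,U)$, and $\lambda(X,Y)=R(X,Y,Y,X)-R(X,Y,JY,JX)$. Suppose that $M$ has pointwise constant type $\alpha$, where $\alpha:M\to\mathbb R$ is a function: for every $p\in M$ and all $X,Y\in T_pM$ with $g(X,Y)=g(JX,Y)=0$ and $g(Y,Y)=1$ one has $\lambda(X,Y)=\alpha(p)\,g(X,X)$. Suppose further that, for some fixed integer $n$ with $1\le n<m$, $M$ satisfies the axiom of coholomorphic $(2n+1)$-spheres: for each $p\in M$ and each $(2n+1)$-dimensional linear subspace $\pi\subset T_pM$ that contains a $2n$-dimensional subspace $\sigma$ with $J\sigma=\sigma$, there is a $(2n+1)$-dimensional totally umbilical (immersed) submanifold $N$ of $M$ through $p$ with $T_pN=\pi$.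 (Totally umbilical means that the second fundamental form of $N$ equals $g(X,Y)H$ for all tangent vectors $X,Y$ of $N$, where $H$ is the mean curvature vector of $N$.) Then there is a constant $c$ such that $\alpha\equiv c$ on $M$, every sectional curvature of $M$ equals $c$, and $M$ has global constant type: $\lambda(X,Y)=c$ for all $p\in M$ and all unit vectors $X,Y\in T_pM$ with $g(X,Y)=g(JX,Y)=0$. -/

import Mathlib

open scoped Manifold ContDiff

noncomputable section

namespace Coholomorphic

/-- The Euclidean space `ℝ^k`, the model space of `k`-dimensional submanifolds. -/
abbrev Euc (k : ℕ) : Type := EuclideanSpace ℝ (Fin k)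

/-! ### Metrics on open subsets of a vector space

A metric is a field `G` of bilinear forms; all quantities below are local in the base point. -/

section Local

variable {E F : Type*} [NormedAddCommGroup E] [NormedSpace ℝ E]
  [NormedAddCommGroup F] [NormedSpace ℝ F]

/-- The Christoffel symbol (Levi-Civita connection in coordinates) of the metric `G` at `y`: the
vector `Γ = Γ_y(u, v)` determined by
`2 G_y(Γ, w) = (D_u G)_y(v, w) + (D_v G)_y(u, w) - (D_w G)_y(u, v)` for all `w`.
In coordinates, `(∇_X Y)(y) = (D_X Y)(y) + Γ_y(X, Y)`. -/
def christoffel (G : E → E →L[ℝ] E →L[ℝ] ℝ) (y u v : E) : E :=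
  (2 : ℝ)⁻¹ • (G y).inverse
    (fderiv ℝ G y u v + fderiv ℝ G y v u - ((fderiv ℝ G y).flip u).flip v)

/-- The curvature tensor `R(u, v) w = ∇_u ∇_v w - ∇_v ∇_u w - ∇_[u, v] w` of the metric `G` at `y`,
for vectors `u, v, w` extended as constant fields. -/
def localCurvature (G : E → E →L[ℝ] E →L[ℝ] ℝ) (y u v w : E) : E :=
  fderiv ℝ (fun z => christoffel G z v w) y u - fderiv ℝ (fun z => christoffel G z u w) y v
    + christoffel G y u (christoffel G y v w) - christoffel G y v (christoffel G y u w)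

/-- The pullback `f^* G` of a metric `G` under a map `f`. -/
def pullbackMetric (G : E → E →L[ℝ] E →L[ℝ] ℝ) (f : F → E) (z : F) : F →L[ℝ] F →L[ℝ] ℝ :=
  (G (f z)).bilinearComp (fderiv ℝ f z) (fderiv ℝ f z)

/-- The second fundamental form `α(u, v) = ∇̃_u v - ∇_u v` at `z` of an immersion `f` into a space
with metric `G`. Here `∇̃` is the Levi-Civita connection of `G`, `∇` the one of the induced metric
`f^* G`, the vectors `u, v` are extended as constant fields on the source, and tangent vectors of
the source are identified with their images under the differential of `f`. -/
def localSecondFundamentalForm (G : E → E →L[ℝ] E →L[ℝ] ℝ) (f : F → E) (z u v : F) : E :=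
  (fderiv ℝ (fun z' => fderiv ℝ f z' v) z u
      + christoffel G (f z) (fderiv ℝ f z u) (fderiv ℝ f z v))
    - fderiv ℝ f z (christoffel (pullbackMetric G f) z u v)

end Local

/-! ### Almost Hermitian manifolds -/

section Manifold

variable (E : Type*) [NormedAddCommGroup E] [NormedSpace ℝ E]
  (M : Type*) [TopologicalSpace M] [ChartedSpace E M] [IsManifold 𝓘(ℝ, E) ∞ M]

/-- An almost Hermitian structure on a smooth manifold `M`: a smooth Riemannian metric `g` and a
smooth field `J` of endomorphisms of the tangent spaces with `J² = -1` and
`g(JX, JY) = g(X, Y)`. -/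
structure AlmostHermitian where
  g : Bundle.ContMDiffRiemannianMetric 𝓘(ℝ, E) ∞ E
    (fun x : M => TangentSpace 𝓘(ℝ, E) x)
  J : ∀ x : M, TangentSpace 𝓘(ℝ, E) x →L[ℝ] TangentSpace 𝓘(ℝ, E) x
  contMDiff_J : ContMDiff 𝓘(ℝ, E) (𝓘(ℝ, E).prod 𝓘(ℝ, E →L[ℝ] E)) ∞
    (fun x => Bundle.TotalSpace.mk' (E →L[ℝ] E)
      (E := fun x : M => TangentSpace 𝓘(ℝ, E) x →L[ℝ] TangentSpace 𝓘(ℝ, E) x) x (J x))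
  J_J : ∀ (x : M) (v : TangentSpace 𝓘(ℝ, E) x), J x (J x v) = -v
  g_J_J : ∀ (x : M) (v w : TangentSpace 𝓘(ℝ, E) x),
    g.inner x (J x v) (J x w) = g.inner x v w

namespace AlmostHermitian

variable {E M}
variable (A : AlmostHermitian E M)

/-- The metric of `M` in the preferred chart `φ` around `p`, as a field of bilinear forms on the
target of `φ`: at `y` it is `(u, v) ↦ g(d(φ⁻¹)_y u, d(φ⁻¹)_y v)`. -/
def chartMetric (p : M) (y : E) : E →L[ℝ] E →L[ℝ] ℝ :=
  let B : E →L[ℝ] E →L[ℝ] ℝ := A.g.inner ((extChartAt 𝓘(ℝ, E) p).symm y)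
  let L : E →L[ℝ] E :=
    mfderiv 𝓘(ℝ, E) 𝓘(ℝ, E) (extChartAt 𝓘(ℝ, E) p).symm y
  B.bilinearComp L L

/-- The curvature operator `R(X, Y) Z` at `p`, computed in the preferred chart around `p` (the
tangent space at `p` is identified with the model space through this chart). -/
def curvature (p : M) (X Y Z : TangentSpace 𝓘(ℝ, E) p) : TangentSpace 𝓘(ℝ, E) p :=
  localCurvature (E := E) (A.chartMetric p) (extChartAt 𝓘(ℝ, E) p p) X Y Z

/-- The curvature tensor `R(X, Y, Z, U) = g(R(X, Y) Z, U)`. -/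
def R (p : M) (X Y Z U : TangentSpace 𝓘(ℝ, E) p) : ℝ :=
  A.g.inner p (A.curvature p X Y Z) U

/-- The sectional curvature of the plane spanned by `X` and `Y`. -/
def sectionalCurvature (p : M) (X Y : TangentSpace 𝓘(ℝ, E) p) : ℝ :=
  A.R p X Y Y X / (A.g.inner p X X * A.g.inner p Y Y - A.g.inner p X Y ^ 2)

/-- `M` is a space of constant (sectional) curvature `c`. -/
def HasConstantCurvature (c : ℝ) : Prop :=
  ∀ (p : M) (X Y : TangentSpace 𝓘(ℝ, E) p), LinearIndependent ℝ ![X, Y] →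
    A.sectionalCurvature p X Y = c

/-- `λ(X, Y) = R(X, Y, Y, X) - R(X, Y, JY, JX)`. -/
def lam (p : M) (X Y : TangentSpace 𝓘(ℝ, E) p) : ℝ :=
  A.R p X Y Y X - A.R p X Y (A.J p Y) (A.J p X)

/-- `M` has pointwise constant type `α`: one has `λ(X, Y) = α(p) g(X, X)` for all `X, Y` in `T_p M`
with `Y` of unit length and orthogonal to `X` and `JX`. -/
def HasPointwiseConstantType (α : M → ℝ) : Prop :=
  ∀ (p : M) (X Y : TangentSpace 𝓘(ℝ, E) p),
    A.g.inner p X Y = 0 → A.g.inner p (A.J p X) Y = 0 → A.g.inner p Y Y = 1 →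
      A.lam p X Y = α p * A.g.inner p X X

/-- `M` has global constant type, with constant `c`: `λ(X, Y) = c` for all points `p` and all unit
vectors `X, Y` in `T_p M` with `g(X, Y) = g(JX, Y) = 0`. -/
def HasGlobalConstantType (c : ℝ) : Prop :=
  ∀ (p : M) (X Y : TangentSpace 𝓘(ℝ, E) p),
    A.g.inner p (A.J p X) Y = 0 → A.g.inner p X Y = 0 →
      A.g.inner p X X = 1 → A.g.inner p Y Y = 1 → A.lam p X Y = c

/-- A linear subspace `σ` of `T_p M` is a holomorphic `2n`-plane: `dim σ = 2n` and `J σ = σ`. -/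
def IsHolomorphicPlane (n : ℕ) (p : M) (σ : Submodule ℝ (TangentSpace 𝓘(ℝ, E) p)) : Prop :=
  Module.finrank ℝ σ = 2 * n ∧ σ.map (A.J p).toLinearMap = σ

/-- A linear subspace `π` of `T_p M` is a coholomorphic `(2n+1)`-plane: it has dimension `2n+1` and
contains a holomorphic `2n`-plane. -/
def IsCoholomorphicPlane (n : ℕ) (p : M) (π : Submodule ℝ (TangentSpace 𝓘(ℝ, E) p)) : Prop :=
  Module.finrank ℝ π = 2 * n + 1 ∧ ∃ σ ≤ π, A.IsHolomorphicPlane n p σ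

section Submanifold

variable (F : Type*) [NormedAddCommGroup F] [NormedSpace ℝ F] [FiniteDimensional ℝ F]
  {N : Type*} [TopologicalSpace N] [ChartedSpace F N]

/-- The second fundamental form at `x` of an immersion `f : N → M`, where `N` is modelled on `F`,
computed in the preferred charts around `x` and `f x`. -/
def secondFundamentalForm (f : N → M) (x : N) (u v : TangentSpace 𝓘(ℝ, F) x) :
    TangentSpace 𝓘(ℝ, E) (f x) :=
  localSecondFundamentalForm (E := E) (F := F) (A.chartMetric (f x))
    (writtenInExtChartAt 𝓘(ℝ, F) 𝓘(ℝ, E) x f) (extChartAt 𝓘(ℝ, F) x x) u v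

/-- The metric induced on `N` by `f : N → M`. -/
def inducedInner (f : N → M) (x : N) (u v : TangentSpace 𝓘(ℝ, F) x) : ℝ :=
  A.g.inner (f x) (mfderiv 𝓘(ℝ, F) 𝓘(ℝ, E) f x u) (mfderiv 𝓘(ℝ, F) 𝓘(ℝ, E) f x v)

/-- A basis of the tangent space of `N` at `x`: the coordinate frame of the preferred chart. -/
def frame (x : N) (i : Fin (Module.finrank ℝ F)) : TangentSpace 𝓘(ℝ, F) x :=
  Module.finBasis ℝ F i

/-- The Gram matrix `(g_ij)` of the induced metric in the basis `frame F x` of `T_x N`. -/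
def gram (f : N → M) (x : N) :
    Matrix (Fin (Module.finrank ℝ F)) (Fin (Module.finrank ℝ F)) ℝ :=
  Matrix.of fun i j => A.inducedInner F f x (frame F x i) (frame F x j)

/-- The mean curvature vector `H = (1/k) trace α` of an immersion `f : N → M`, `k = dim N`. The
trace with respect to the induced metric is `∑ i j, g^{ij} α(e_i, e_j)`, for a basis `e` of `T_x N`
and the inverse `(g^{ij})` of its Gram matrix. -/
def meanCurvature (f : N → M) (x : N) : TangentSpace 𝓘(ℝ, E) (f x) :=
  (Module.finrank ℝ F : ℝ)⁻¹ • ∑ i, ∑ j,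
    (A.gram F f x)⁻¹ i j • A.secondFundamentalForm F f x (frame F x i) (frame F x j)

/-- The map `f : N → M` exhibits `N` as a totally umbilical submanifold of `M`: it is a smooth
immersion with `α(X, Y) = g(X, Y) H` for all tangent vectors `X, Y` of `N`. -/
structure IsTotallyUmbilical (f : N → M) : Prop where
  contMDiff : ContMDiff 𝓘(ℝ, F) 𝓘(ℝ, E) ∞ f
  injective_mfderiv : ∀ x, Function.Injective (mfderiv 𝓘(ℝ, F) 𝓘(ℝ, E) f x)
  umbilical : ∀ (x : N) (u v : TangentSpace 𝓘(ℝ, F) x),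
    A.secondFundamentalForm F f x u v = A.inducedInner F f x u v • A.meanCurvature F f x

end Submanifold

end AlmostHermitian

end Manifold

/-- The axiom of coholomorphic `(2n+1)`-spheres: for each point `p` of `M` and each coholomorphic
`(2n+1)`-plane `π` in `T_p M` there is a `(2n+1)`-dimensional totally umbilical submanifold `N` of
`M` containing `p` such that `T_p N = π`. -/
def AlmostHermitian.SatisfiesCoholomorphicSpheres.{u, v} {E : Type v} [NormedAddCommGroup E]
    [NormedSpace ℝ E] {M : Type u} [TopologicalSpace M] [ChartedSpace E M]
    [IsManifold 𝓘(ℝ, E) ∞ M] (A : AlmostHermitian E M) (n : ℕ) : Prop :=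
  ∀ (p : M) (π : Submodule ℝ (TangentSpace 𝓘(ℝ, E) p)), A.IsCoholomorphicPlane n p π →
    ∃ (N : Type u) (_ : TopologicalSpace N) (_ : ChartedSpace (Euc (2 * n + 1)) N)
      (_ : IsManifold 𝓘(ℝ, Euc (2 * n + 1)) ∞ N) (f : N → M) (x : N) (hx : f x = p),
      A.IsTotallyUmbilical (Euc (2 * n + 1)) f ∧
        hx ▸ LinearMap.range (mfderiv 𝓘(ℝ, Euc (2 * n + 1)) 𝓘(ℝ, E) f x).toLinearMap = π

end Coholomorphic

end

/-!
Why the theorem is true.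

**Curvature at one point.** Let `N` be totally umbilical with mean curvature vector `H`. The Codazzi
equation (`localCurvature_of_umbilical`, `codazzi_of_umbilical`) says that the part of `R(X, Y) Z`
normal to `N` is that of `g(Y, Z) ∇_X H - g(X, Z) ∇_Y H`, so `R(X, Y, Z, ξ) = 0` for `X, Y, Z`
tangent to `N` with `Z` orthogonal to `X` and `Y`, and `ξ` normal to `N`. A coholomorphic plane
spanned by a holomorphic plane and a vector `f` orthogonal to it has `Jf` as a normal vector; hence
this holds for `ξ = Jf` and `X, Y, Z` in the span of `x, Jx, f` whenever `f` is orthogonal to `x`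
and `Jx`. In particular `R(x, f, Jx, Jf) = 0`, so `λ(x, f) = R(x, f, f, x)`, and constant type says
that all planes spanned by such `x, f` have sectional curvature `α`.

Let `T = R - α R₀`, where `R₀` is the curvature tensor of a space of constant curvature one. Applied
to `a + b` and `Ja - Jb`, with `b` of the same length as `a` and orthogonal to `a` and `Ja`, the
vanishing of `T` on these planes says that `T(a, Ja, Ja, a) + T(b, Jb, Jb, b) = 0`. As the complex
dimension is at least three, there are three pairwise orthogonal choices, so each term vanishes.
Three polarizations then kill the mixed terms `T(x, Jx, f, x)`, whence all sectional curvatures of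
`T` vanish and `T = 0` (`IsCurvatureLike.eq_zero_of_codazzi`,
`IsCurvatureLike.eq_of_constant_type`).

**Constancy of `α`.** This is Schur's lemma (`fderiv_eq_zero_of_curvature`), a consequence of the
second Bianchi identity, carried out in one chart. Global constant type is then immediate from
pointwise constant type.

**Changing charts.** Curvature and second fundamental form at a point are defined through the
preferred chart of that very point, whereas differentiating along `N`, or differentiating `α`,
compares nearby points. Everything needed follows from one fact: the second fundamental form
`∇̃_u (Df v) - Df (∇_u v)` of an immersion is normal (`inner_localSecondFundamentalForm`), so it is
zero for a local diffeomorphism. This is the transformation law of the Christoffel symbols; it makes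
the second fundamental form independent of the charts, and, put into the Gauss-Codazzi formula, it
makes the curvature natural (`localCurvature_pullback`).
-/

noncomputable section

namespace Coholomorphic

open Filter Topology Function

/-! ### Christoffel symbols and curvature of a metric on a vector space -/

section LocalGeometry

-- needed to find the normed space structure on trilinear maps
set_option maxSynthPendingDepth 3

variable {E F : Type*} [NormedAddCommGroup E] [NormedSpace ℝ E]
  [NormedAddCommGroup F] [NormedSpace ℝ F]

/-- `G` is smooth at `y`, and `G y` is an inner product. A Riemannian metric near `y` is
expressed as `∀ᶠ z in 𝓝 y, IsMetricAt G z`. -/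
structure IsMetricAt (G : E → E →L[ℝ] E →L[ℝ] ℝ) (y : E) : Prop where
  contDiffAt : ContDiffAt ℝ ∞ G y
  symm : ∀ u v, G y u v = G y v u
  pos : ∀ u, u ≠ 0 → 0 < G y u u

/-- The right-hand side of the Koszul formula,
`(u, v, w) ↦ D u v w + D v u w - D w u v`, as a function of the derivative `D` of the metric. -/
def koszul (D : E →L[ℝ] E →L[ℝ] E →L[ℝ] ℝ) : E →L[ℝ] E →L[ℝ] E →L[ℝ] ℝ :=
  D + D.flip -
    (ContinuousLinearMap.flipₗᵢ ℝ E E ℝ).toContinuousLinearEquiv.toContinuousLinearMap.comp D.flip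

theorem koszul_apply (D : E →L[ℝ] E →L[ℝ] E →L[ℝ] ℝ) (u v : E) :
    koszul D u v = D u v + D v u - (D.flip u).flip v := rfl

/-- The Christoffel symbol as a field of bilinear maps, so that it can be differentiated. -/
def christoffelL (G : E → E →L[ℝ] E →L[ℝ] ℝ) (y : E) : E →L[ℝ] E →L[ℝ] E :=
  (2 : ℝ)⁻¹ • (ContinuousLinearMap.compL ℝ E (E →L[ℝ] ℝ) E (G y).inverse).comp
    (koszul (fderiv ℝ G y))

theorem christoffel_eq (G : E → E →L[ℝ] E →L[ℝ] ℝ) (y u v : E) :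
    christoffel G y u v = christoffelL G y u v := rfl

theorem _root_.ContDiffAt.of_clm_apply {D : Type*} [NormedAddCommGroup D] [NormedSpace ℝ D]
    [FiniteDimensional ℝ E] {n : WithTop ℕ∞} {f : D → E →L[ℝ] F} {x : D}
    (h : ∀ u, ContDiffAt ℝ n (fun z => f z u) x) : ContDiffAt ℝ n f x := by
  let d := Module.finrank ℝ E
  have hd : d = Module.finrank ℝ (Fin d → ℝ) := (Module.finrank_fin_fun ℝ).symm
  let e₁ := ContinuousLinearEquiv.ofFinrankEq hd
  let e₂ := (e₁.arrowCongr (1 : F ≃L[ℝ] F)).trans (ContinuousLinearEquiv.piRing (Fin d))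
  rw [← id_comp f, ← e₂.symm_comp_self]
  exact e₂.symm.contDiff.contDiffAt.comp x (contDiffAt_pi.mpr fun i => h _)

variable [FiniteDimensional ℝ E] {G : E → E →L[ℝ] E →L[ℝ] ℝ} {y : E}

theorem IsMetricAt.isInvertible (h : IsMetricAt G y) : (G y).IsInvertible := by
  have hinj : Function.Injective (G y) := by
    rw [injective_iff_map_eq_zero]
    intro u hu
    by_contra hne
    have := h.pos u hne
    rw [hu] at this
    simp at this
  have hdim : Module.finrank ℝ E = Module.finrank ℝ (E →L[ℝ] ℝ) := by
    rw [← (LinearMap.toContinuousLinearMap (𝕜 := ℝ) (E := E) (F' := ℝ)).finrank_eq]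
    exact (Subspace.dual_finrank_eq).symm
  have hinj' : Function.Injective (G y).toLinearMap := hinj
  let e := (LinearEquiv.ofInjectiveOfFinrankEq (G y).toLinearMap hinj' hdim).toContinuousLinearEquiv
  exact ⟨e, by ext; rfl⟩

omit [FiniteDimensional ℝ E] in
theorem IsMetricAt.eq_of_forall (h : IsMetricAt G y) {a b : E} (hab : ∀ w, G y a w = G y b w) :
    a = b := by
  by_contra hne
  have := h.pos (a - b) (sub_ne_zero.2 hne)
  simp [hab] at this

theorem IsMetricAt.contDiffAt_christoffelL (h : IsMetricAt G y) :
    ContDiffAt ℝ ∞ (christoffelL G) y := by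
  have h1 : ContDiffAt ℝ ∞ (fun z => (G z).inverse) y :=
    (h.isInvertible.contDiffAt_map_inverse).comp y h.contDiffAt
  have h2 : ContDiffAt ℝ ∞ (fderiv ℝ G) y := h.contDiffAt.fderiv_right (m := ∞) (by simp)
  refine ContDiffAt.of_clm_apply fun u => ContDiffAt.of_clm_apply fun v => ?_
  have h3 : ContDiffAt ℝ ∞ (fun z => koszul (fderiv ℝ G z) u v) y := by
    refine ContDiffAt.of_clm_apply fun w => ?_
    simp only [koszul_apply, sub_apply, add_apply, ContinuousLinearMap.flip_apply]
    fun_prop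
  exact (h1.clm_apply h3).const_smul (2 : ℝ)⁻¹

/-- The Koszul formula. -/
theorem IsMetricAt.koszul_formula (h : IsMetricAt G y) (u v w : E) :
    2 * G y (christoffelL G y u v) w
      = fderiv ℝ G y u v w + fderiv ℝ G y v u w - fderiv ℝ G y w u v := by
  have : G y ((G y).inverse (koszul (fderiv ℝ G y) u v)) = koszul (fderiv ℝ G y) u v := by
    obtain ⟨e, he⟩ := h.isInvertible
    rw [← he]; simp
  simp only [christoffelL, smul_apply, ContinuousLinearMap.comp_apply,
    ContinuousLinearMap.compL_apply, map_smul, this, smul_eq_mul]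
  rw [koszul_apply]
  simp

omit [FiniteDimensional ℝ E] in
theorem fderiv_metric_symm (h : ∀ᶠ z in 𝓝 y, IsMetricAt G z) (u v w : E) :
    fderiv ℝ G y u v w = fderiv ℝ G y u w v := by
  have hd := h.self_of_nhds.contDiffAt.differentiableAt (by simp)
  have e : ∀ v w, fderiv ℝ G y u v w = fderiv ℝ (fun z => G z v w) y u := by
    intro v w
    rw [fderiv_clm_apply (by fun_prop) (by fun_prop), fderiv_clm_apply hd (by fun_prop)]
    simp
  rw [e, e]
  have : (fun z => G z v w) =ᶠ[𝓝 y] fun z => G z w v := h.mono fun z hz => hz.symm v w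
  rw [this.fderiv_eq]

/-- The Levi-Civita connection is torsion-free. -/
theorem christoffelL_symm (h : ∀ᶠ z in 𝓝 y, IsMetricAt G z) (u v : E) :
    christoffelL G y u v = christoffelL G y v u := by
  have hy := h.self_of_nhds
  refine hy.eq_of_forall fun w => ?_
  have h1 := hy.koszul_formula u v w
  have h2 := hy.koszul_formula v u w
  have h3 := fderiv_metric_symm h w u v
  linarith

/-- The Levi-Civita connection is compatible with the metric. -/
theorem fderiv_metric (h : ∀ᶠ z in 𝓝 y, IsMetricAt G z) (u v w : E) :
    fderiv ℝ G y u v w = G y (christoffelL G y u v) w + G y v (christoffelL G y u w) := by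
  have hy := h.self_of_nhds
  have h1 := hy.koszul_formula u v w
  have h2 := hy.koszul_formula u w v
  have h3 := fderiv_metric_symm h u v w
  have h4 := fderiv_metric_symm h v u w
  have h5 := fderiv_metric_symm h w u v
  rw [hy.symm v]
  linarith

omit [FiniteDimensional ℝ E] in
theorem fderiv_apply_apply {D : Type*} [NormedAddCommGroup D] [NormedSpace ℝ D]
    {A : F → E →L[ℝ] E →L[ℝ] D} {z : F} (hA : DifferentiableAt ℝ A z)
    (u : F) (v w : E) : fderiv ℝ (fun z => A z v w) z u = fderiv ℝ A z u v w := by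
  rw [fderiv_clm_apply (by fun_prop) (by fun_prop), fderiv_clm_apply hA (by fun_prop)]
  simp

theorem localCurvature_eq (h : IsMetricAt G y) (u v w : E) :
    localCurvature G y u v w = fderiv ℝ (christoffelL G) y u v w - fderiv ℝ (christoffelL G) y v u w
      + christoffelL G y u (christoffelL G y v w) - christoffelL G y v (christoffelL G y u w) := by
  have hd : DifferentiableAt ℝ (christoffelL G) y :=
    h.contDiffAt_christoffelL.differentiableAt (by simp)
  have e : ∀ u v w, fderiv ℝ (fun z => christoffelL G z v w) y u
      = fderiv ℝ (christoffelL G) y u v w := fun u v w => by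
    exact fderiv_apply_apply hd u v w
  simp only [localCurvature, christoffel_eq, e]

theorem fderiv_christoffelL_symm (h : ∀ᶠ z in 𝓝 y, IsMetricAt G z) (u v w : E) :
    fderiv ℝ (christoffelL G) y u v w = fderiv ℝ (christoffelL G) y u w v := by
  have hd : DifferentiableAt ℝ (christoffelL G) y :=
    h.self_of_nhds.contDiffAt_christoffelL.differentiableAt (by simp)
  rw [← fderiv_apply_apply hd, ← fderiv_apply_apply hd]
  have : (fun z => christoffelL G z v w) =ᶠ[𝓝 y] fun z => christoffelL G z w v :=
    h.eventually_nhds.mono fun z hz => christoffelL_symm hz v w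
  rw [this.fderiv_eq]

/-- The first Bianchi identity. -/
theorem localCurvature_bianchi (h : ∀ᶠ z in 𝓝 y, IsMetricAt G z) (u v w : E) :
    localCurvature G y u v w + localCurvature G y v w u + localCurvature G y w u v = 0 := by
  simp only [localCurvature_eq h.self_of_nhds]
  rw [fderiv_christoffelL_symm h u v w, fderiv_christoffelL_symm h v u w,
    fderiv_christoffelL_symm h w v u, christoffelL_symm h u v, christoffelL_symm h v w,
    christoffelL_symm h u w]
  abel

end LocalGeometry

/-! ### Covariant differentiation along a map -/

section AlongMap

set_option maxSynthPendingDepth 3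

variable {E F : Type*} [NormedAddCommGroup E] [NormedSpace ℝ E]
  [NormedAddCommGroup F] [NormedSpace ℝ F]

theorem two_le_infty : (2 : WithTop ℕ∞) ≤ ∞ := by
  exact WithTop.coe_le_coe.2 (le_top : (2 : ℕ∞) ≤ ⊤)

/-- The covariant derivative `∇_u X` at `z`, for the Levi-Civita connection of `G`, of a vector
field `X` along the map `f`. -/
def covAlong (G : E → E →L[ℝ] E →L[ℝ] ℝ) (f X : F → E) (z u : F) : E :=
  fderiv ℝ X z u + christoffelL G (f z) (fderiv ℝ f z u) (X z)

/-- `f` is smooth at `z` with injective differential. -/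
structure IsImmersiveAt (f : F → E) (z : F) : Prop where
  contDiffAt : ContDiffAt ℝ ∞ f z
  injective : Injective (fderiv ℝ f z)

variable {G : E → E →L[ℝ] E →L[ℝ] ℝ} {f X Y : F → E} {z : F}

theorem covAlong_congr (h : X =ᶠ[𝓝 z] Y) (u : F) : covAlong G f X z u = covAlong G f Y z u := by
  simp only [covAlong, h.fderiv_eq, h.self_of_nhds]

theorem covAlong_add (hX : DifferentiableAt ℝ X z) (hY : DifferentiableAt ℝ Y z) (u : F) :
    covAlong G f (fun z => X z + Y z) z u = covAlong G f X z u + covAlong G f Y z u := by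
  simp only [covAlong, fderiv_fun_add hX hY, map_add, add_apply]
  abel

theorem covAlong_sub (hX : DifferentiableAt ℝ X z) (hY : DifferentiableAt ℝ Y z) (u : F) :
    covAlong G f (fun z => X z - Y z) z u = covAlong G f X z u - covAlong G f Y z u := by
  simp only [covAlong, fderiv_fun_sub hX hY, map_sub, sub_apply]
  abel

/-- The Leibniz rule. -/
theorem covAlong_smul {s : F → ℝ} (hs : DifferentiableAt ℝ s z) (hX : DifferentiableAt ℝ X z)
    (u : F) :
    covAlong G f (fun z => s z • X z) z u = s z • covAlong G f X z u + fderiv ℝ s z u • X z := by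
  simp only [covAlong, fderiv_fun_smul hs hX, map_smul, add_apply, smul_apply,
    ContinuousLinearMap.smulRight_apply, smul_add]
  abel

variable [FiniteDimensional ℝ E]

/-- Metric compatibility along a map. -/
theorem fderiv_metric_along (hG : ∀ᶠ y in 𝓝 (f z), IsMetricAt G y)
    (hf : DifferentiableAt ℝ f z) (hX : DifferentiableAt ℝ X z) (hY : DifferentiableAt ℝ Y z)
    (u : F) :
    fderiv ℝ (fun z => G (f z) (X z) (Y z)) z u
      = G (f z) (covAlong G f X z u) (Y z) + G (f z) (X z) (covAlong G f Y z u) := by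
  have hGd := hG.self_of_nhds.contDiffAt.differentiableAt (by simp)
  have hGf : DifferentiableAt ℝ (fun z => G (f z)) z := hGd.comp z hf
  have hGX : DifferentiableAt ℝ (fun z => G (f z) (X z)) z := hGf.clm_apply hX
  have e : fderiv ℝ (fun z => G (f z)) z = (fderiv ℝ G (f z)).comp (fderiv ℝ f z) :=
    fderiv_comp z hGd hf
  rw [fderiv_clm_apply hGX hY, fderiv_clm_apply hGf hX, e]
  have := fderiv_metric hG (fderiv ℝ f z u) (X z) (Y z)
  simp only [covAlong, add_apply, ContinuousLinearMap.comp_apply, ContinuousLinearMap.flip_apply,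
    map_add, this]
  ring

/-- Covariant derivatives along a map commute up to curvature. -/
theorem covAlong_comm (hG : ∀ᶠ y in 𝓝 (f z), IsMetricAt G y)
    (hf : ContDiffAt ℝ ∞ f z) (hX : ContDiffAt ℝ ∞ X z) (u v : F) :
    covAlong G f (fun z => covAlong G f X z v) z u - covAlong G f (fun z => covAlong G f X z u) z v
      = localCurvature G (f z) (fderiv ℝ f z u) (fderiv ℝ f z v) (X z) := by
  have hΓ := hG.self_of_nhds.contDiffAt_christoffelL.differentiableAt (by simp)
  have hfd := hf.differentiableAt (by simp)
  have hXd := hX.differentiableAt (by simp)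
  have hf' : DifferentiableAt ℝ (fderiv ℝ f) z :=
    (hf.fderiv_right (m := ∞) (by simp)).differentiableAt (by simp)
  have hX' : DifferentiableAt ℝ (fderiv ℝ X) z :=
    (hX.fderiv_right (m := ∞) (by simp)).differentiableAt (by simp)
  have hΓf : DifferentiableAt ℝ (fun z => christoffelL G (f z)) z := hΓ.comp z hfd
  have e : fderiv ℝ (fun z => christoffelL G (f z)) z
      = (fderiv ℝ (christoffelL G) (f z)).comp (fderiv ℝ f z) := fderiv_comp z hΓ hfd
  have hf'v : ∀ v, DifferentiableAt ℝ (fun z => fderiv ℝ f z v) z := fun v => by fun_prop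
  have key : ∀ u v, fderiv ℝ (fun z => covAlong G f X z v) z u
      = fderiv ℝ (fderiv ℝ X) z u v
        + (christoffelL G (f z) (fderiv ℝ f z v) (fderiv ℝ X z u)
          + (christoffelL G (f z) (fderiv ℝ (fderiv ℝ f) z u v) (X z)
          + fderiv ℝ (christoffelL G) (f z) (fderiv ℝ f z u) (fderiv ℝ f z v) (X z))) := by
    intro u v
    unfold covAlong
    have h1 : DifferentiableAt ℝ (fun z => christoffelL G (f z) (fderiv ℝ f z v)) z :=
      hΓf.clm_apply (hf'v v)
    have h2 : DifferentiableAt ℝ (fun z => christoffelL G (f z) (fderiv ℝ f z v) (X z)) z :=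
      h1.clm_apply hXd
    rw [fderiv_fun_add (by fun_prop) h2, fderiv_clm_apply h1 hXd, fderiv_clm_apply hΓf (hf'v v), e,
      fderiv_clm_apply hX' (by fun_prop), fderiv_clm_apply hf' (by fun_prop)]
    simp
  have sX := (hX.isSymmSndFDerivAt (by simpa using two_le_infty)).eq u v
  have sf := (hf.isSymmSndFDerivAt (by simpa using two_le_infty)).eq u v
  have cov : ∀ W u, covAlong G f W z u
      = fderiv ℝ W z u + christoffelL G (f z) (fderiv ℝ f z u) (W z) := fun _ _ => rfl
  rw [cov (fun z => covAlong G f X z v), cov (fun z => covAlong G f X z u), key, key, cov, cov,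
    localCurvature_eq hG.self_of_nhds, sX, sf]
  simp only [map_add]
  abel

/-- The curvature operator is skew-symmetric. -/
theorem localCurvature_skew {y : E} (hG : ∀ᶠ y in 𝓝 y, IsMetricAt G y) (u v w w' : E) :
    G y (localCurvature G y u v w) w' + G y w (localCurvature G y u v w') = 0 := by
  have hGy := hG.self_of_nhds
  have hcov : ∀ w u : E, ∀ x, covAlong G id (fun _ => w) x u = christoffelL G x u w := by
    intro w u x; simp [covAlong]
  have hd : ∀ u w : E, DifferentiableAt ℝ (fun x => covAlong G id (fun _ => w) x u) y := by
    intro u w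
    simp only [hcov]
    have := hGy.contDiffAt_christoffelL.differentiableAt (by simp)
    fun_prop
  have hφ : ContDiffAt ℝ ∞ (fun x => G x w w') y := by
    have := hGy.contDiffAt
    fun_prop
  have h1 : ∀ v, (fun x => fderiv ℝ (fun x => G x w w') x v) =ᶠ[𝓝 y]
      fun x => G x (covAlong G id (fun _ => w) x v) w' + G x w (covAlong G id (fun _ => w') x v) :=
    fun v => hG.eventually_nhds.mono fun x hx =>
      fderiv_metric_along (f := id) hx (by fun_prop) (by fun_prop) (by fun_prop) v
  have hGd := hGy.contDiffAt.differentiableAt (by simp)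
  have hφ' : DifferentiableAt ℝ (fderiv ℝ (fun x => G x w w')) y :=
    (hφ.fderiv_right (m := ∞) (by simp)).differentiableAt (by simp)
  have h2 : ∀ u v, fderiv ℝ (fderiv ℝ (fun x => G x w w')) y u v
      = (G y (covAlong G id (fun x => covAlong G id (fun _ => w) x v) y u) w'
        + G y (covAlong G id (fun _ => w) y v) (covAlong G id (fun _ => w') y u))
        + (G y (covAlong G id (fun _ => w) y u) (covAlong G id (fun _ => w') y v)
        + G y w (covAlong G id (fun x => covAlong G id (fun _ => w') x v) y u)) := by
    intro u v
    have : fderiv ℝ (fderiv ℝ (fun x => G x w w')) y u v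
        = fderiv ℝ (fun x => fderiv ℝ (fun x => G x w w') x v) y u := by
      rw [fderiv_clm_apply hφ' (by fun_prop)]; simp
    rw [this, (h1 v).fderiv_eq, fderiv_fun_add
      ((hGd.clm_apply (hd v w)).clm_apply (by fun_prop))
      ((hGd.clm_apply (by fun_prop)).clm_apply (hd v w')), add_apply]
    congr 1
    · exact fderiv_metric_along (f := id) (Y := fun _ => w') hG (by fun_prop) (hd v w)
        (by fun_prop) u
    · exact fderiv_metric_along (f := id) (X := fun _ => w) hG (by fun_prop) (by fun_prop)
        (hd v w') u
  have hs := (hφ.isSymmSndFDerivAt (by simpa using two_le_infty)).eq u v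
  rw [h2, h2] at hs
  have c1 := covAlong_comm (f := id) (X := fun _ => w) hG (by fun_prop) (by fun_prop) u v
  have c2 := covAlong_comm (f := id) (X := fun _ => w') hG (by fun_prop) (by fun_prop) u v
  simp only [fderiv_id, ContinuousLinearMap.id_apply, id] at c1 c2
  rw [← c1, ← c2]
  simp only [map_sub, sub_apply]
  linarith

end AlongMap

/-! ### Immersions: second fundamental form, Gauss and Codazzi equations -/

section Immersion

set_option maxSynthPendingDepth 3

variable {E F : Type*} [NormedAddCommGroup E] [NormedSpace ℝ E]
  [NormedAddCommGroup F] [NormedSpace ℝ F]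
  {G : E → E →L[ℝ] E →L[ℝ] ℝ} {f : F → E} {z : F}

theorem pullbackMetric_apply (u v : F) :
    pullbackMetric G f z u v = G (f z) (fderiv ℝ f z u) (fderiv ℝ f z v) := rfl

theorem IsMetricAt.pullback [FiniteDimensional ℝ F] (hG : IsMetricAt G (f z))
    (hf : IsImmersiveAt f z) : IsMetricAt (pullbackMetric G f) z where
  contDiffAt := by
    refine ContDiffAt.of_clm_apply fun u => ContDiffAt.of_clm_apply fun v => ?_
    simp only [pullbackMetric_apply]
    have h1 : ContDiffAt ℝ ∞ (fun z => G (f z)) z := hG.contDiffAt.comp z hf.contDiffAt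
    have h2 : ContDiffAt ℝ ∞ (fderiv ℝ f) z := hf.contDiffAt.fderiv_right (m := ∞) (by simp)
    exact (h1.clm_apply (h2.clm_apply contDiffAt_const)).clm_apply (h2.clm_apply contDiffAt_const)
  symm u v := hG.symm _ _
  pos u hu := hG.pos _ fun h => hu (hf.injective (h.trans (map_zero _).symm))

theorem eventually_isMetricAt_pullback [FiniteDimensional ℝ F]
    (hG : ∀ᶠ y in 𝓝 (f z), IsMetricAt G y) (hf : ∀ᶠ x in 𝓝 z, IsImmersiveAt f x) :
    ∀ᶠ x in 𝓝 z, IsMetricAt (pullbackMetric G f) x := by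
  filter_upwards [hf.self_of_nhds.contDiffAt.continuousAt.eventually hG, hf] with x h1 h2
  exact h1.pullback h2

/-- The Gauss formula. -/
theorem localSecondFundamentalForm_eq (u v : F) :
    localSecondFundamentalForm G f z u v = covAlong G f (fun x => fderiv ℝ f x v) z u
      - fderiv ℝ f z (christoffelL (pullbackMetric G f) z u v) := rfl

variable [FiniteDimensional ℝ E]

omit [FiniteDimensional ℝ E] in
theorem covAlong_fderiv_apply (hf : ContDiffAt ℝ ∞ f z) (u v : F) :
    covAlong G f (fun x => fderiv ℝ f x v) z u
      = fderiv ℝ (fderiv ℝ f) z u v + christoffelL G (f z) (fderiv ℝ f z u) (fderiv ℝ f z v) := by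
  have hf' : DifferentiableAt ℝ (fderiv ℝ f) z :=
    (hf.fderiv_right (m := ∞) (by simp)).differentiableAt (by simp)
  unfold covAlong
  rw [fderiv_clm_apply hf' (by fun_prop)]
  simp

/-- Symmetry of the Hessian of a map, which is the symmetry of its second fundamental form. -/
theorem covAlong_fderiv_symm (hG : ∀ᶠ y in 𝓝 (f z), IsMetricAt G y) (hf : ContDiffAt ℝ ∞ f z)
    (u v : F) :
    covAlong G f (fun x => fderiv ℝ f x v) z u = covAlong G f (fun x => fderiv ℝ f x u) z v := by
  rw [covAlong_fderiv_apply hf, covAlong_fderiv_apply hf, christoffelL_symm hG,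
    (hf.isSymmSndFDerivAt (by simpa using two_le_infty)).eq u v]

/-- The second fundamental form is normal to the submanifold. -/
theorem inner_localSecondFundamentalForm [FiniteDimensional ℝ F]
    (hG : ∀ᶠ y in 𝓝 (f z), IsMetricAt G y) (hf : ∀ᶠ x in 𝓝 z, IsImmersiveAt f x) (u v w : F) :
    G (f z) (localSecondFundamentalForm G f z u v) (fderiv ℝ f z w) = 0 := by
  have hfz := hf.self_of_nhds.contDiffAt
  have hf' : DifferentiableAt ℝ (fderiv ℝ f) z :=
    (hfz.fderiv_right (m := ∞) (by simp)).differentiableAt (by simp)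
  have hGy := hG.self_of_nhds
  have hh := eventually_isMetricAt_pullback hG hf
  have hd : DifferentiableAt ℝ (pullbackMetric G f) z :=
    hh.self_of_nhds.contDiffAt.differentiableAt (by simp)
  have key : ∀ u v w : F, fderiv ℝ (pullbackMetric G f) z u v w
      = G (f z) (covAlong G f (fun x => fderiv ℝ f x v) z u) (fderiv ℝ f z w)
        + G (f z) (fderiv ℝ f z v) (covAlong G f (fun x => fderiv ℝ f x w) z u) := by
    intro u v w
    have e : fderiv ℝ (pullbackMetric G f) z u v w
        = fderiv ℝ (fun x => pullbackMetric G f x v w) z u := by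
      rw [fderiv_clm_apply (by fun_prop) (by fun_prop), fderiv_clm_apply hd (by fun_prop)]
      simp
    rw [e]
    exact fderiv_metric_along (X := fun x => fderiv ℝ f x v) (Y := fun x => fderiv ℝ f x w) hG
      (hfz.differentiableAt (by simp)) (by fun_prop) (by fun_prop) u
  have h1 := hh.self_of_nhds.koszul_formula u v w
  rw [key, key, key, pullbackMetric_apply, covAlong_fderiv_symm hG hfz v u,
    covAlong_fderiv_symm hG hfz w u, covAlong_fderiv_symm hG hfz w v,
    hGy.symm (fderiv ℝ f z v), hGy.symm (fderiv ℝ f z u)] at h1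
  rw [localSecondFundamentalForm_eq, map_sub, sub_apply]
  rw [hGy.symm (covAlong G f (fun x => fderiv ℝ f x w) z v)] at h1
  linarith

/-- A local diffeomorphism onto an open set is totally geodesic. -/
theorem localSecondFundamentalForm_eq_zero [FiniteDimensional ℝ F]
    (hG : ∀ᶠ y in 𝓝 (f z), IsMetricAt G y) (hf : ∀ᶠ x in 𝓝 z, IsImmersiveAt f x)
    (hs : Surjective (fderiv ℝ f z)) (u v : F) : localSecondFundamentalForm G f z u v = 0 := by
  refine hG.self_of_nhds.eq_of_forall fun w => ?_
  obtain ⟨w, rfl⟩ := hs w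
  rw [inner_localSecondFundamentalForm hG hf, map_zero, zero_apply]

/-- The Gauss and Codazzi equations of a totally umbilical immersion, in one formula: `f^* G` is the
induced metric and `H` the mean curvature field. -/
theorem localCurvature_of_umbilical [FiniteDimensional ℝ F]
    (hG : ∀ᶠ y in 𝓝 (f z), IsMetricAt G y) (hf : ∀ᶠ x in 𝓝 z, IsImmersiveAt f x)
    {H : F → E} (hH : DifferentiableAt ℝ H z)
    (humb : ∀ᶠ x in 𝓝 z, ∀ u v,
      localSecondFundamentalForm G f x u v = pullbackMetric G f x u v • H x) (u v w : F) :
    localCurvature G (f z) (fderiv ℝ f z u) (fderiv ℝ f z v) (fderiv ℝ f z w)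
      = fderiv ℝ f z (localCurvature (pullbackMetric G f) z u v w)
        + pullbackMetric G f z v w • covAlong G f H z u
        - pullbackMetric G f z u w • covAlong G f H z v := by
  have hfz := hf.self_of_nhds.contDiffAt
  have hf' : ContDiffAt ℝ ∞ (fderiv ℝ f) z := hfz.fderiv_right (m := ∞) (by simp)
  have hf'd := hf'.differentiableAt (by simp)
  have hh := eventually_isMetricAt_pullback hG hf
  set h := pullbackMetric G f with hdef
  have hhd : DifferentiableAt ℝ h z := hh.self_of_nhds.contDiffAt.differentiableAt (by simp)
  have hΓd : DifferentiableAt ℝ (christoffelL h) z :=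
    hh.self_of_nhds.contDiffAt_christoffelL.differentiableAt (by simp)
  have umb : ∀ u v, covAlong G f (fun x => fderiv ℝ f x v) z u
      = fderiv ℝ f z (christoffelL h z u v) + h z u v • H z := by
    intro u v
    have := humb.self_of_nhds u v
    rw [localSecondFundamentalForm_eq, sub_eq_iff_eq_add] at this
    rw [this, add_comm]
  -- the covariant derivative of a tangent field
  have tang : ∀ (c : F → F) (_ : DifferentiableAt ℝ c z) (u : F),
      covAlong G f (fun x => fderiv ℝ f x (c x)) z u
        = fderiv ℝ f z (fderiv ℝ c z u + christoffelL h z u (c z)) + h z u (c z) • H z := by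
    intro c hc u
    have h1 := umb u (c z)
    rw [covAlong_fderiv_apply hfz] at h1
    rw [map_add, add_assoc, ← h1]
    unfold covAlong
    rw [fderiv_clm_apply hf'd hc]
    simp only [add_apply, ContinuousLinearMap.comp_apply, ContinuousLinearMap.flip_apply]
    abel
  have second : ∀ u v, covAlong G f (fun x => covAlong G f (fun x => fderiv ℝ f x w) x v) z u
      = fderiv ℝ f z (fderiv ℝ (christoffelL h) z u v w
          + christoffelL h z u (christoffelL h z v w)) + h z u (christoffelL h z v w) • H z
        + (h z v w • covAlong G f H z u + fderiv ℝ h z u v w • H z) := by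
    intro u v
    have e : (fun x => covAlong G f (fun x => fderiv ℝ f x w) x v) =ᶠ[𝓝 z]
        fun x => fderiv ℝ f x (christoffelL h x v w) + h x v w • H x := by
      refine humb.mono fun x hx => ?_
      have := hx v w
      rw [localSecondFundamentalForm_eq, sub_eq_iff_eq_add, add_comm] at this
      exact this
    have hc : DifferentiableAt ℝ (fun x => christoffelL h x v w) z := by fun_prop
    have hs : DifferentiableAt ℝ (fun x => h x v w) z := by fun_prop
    have e2 : fderiv ℝ (fun x => h x v w) z u = fderiv ℝ h z u v w := by
      rw [fderiv_clm_apply (by fun_prop) (by fun_prop), fderiv_clm_apply hhd (by fun_prop)]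
      simp
    rw [covAlong_congr e, covAlong_add (hf'd.clm_apply hc) (hs.fun_smul hH), tang _ hc,
      covAlong_smul hs hH, e2, fderiv_apply_apply hΓd]
  have hcomm := covAlong_comm hG hfz (X := fun x => fderiv ℝ f x w) (by fun_prop) u v
  rw [← hcomm, second, second, localCurvature_eq hh.self_of_nhds, fderiv_metric hh u v w,
    fderiv_metric hh v u w, christoffelL_symm hh u v]
  simp only [map_add, map_sub, add_smul]
  rw [hh.self_of_nhds.symm u (christoffelL h z v w), hh.self_of_nhds.symm v (christoffelL h z u w)]
  abel

/-- The curvature tensor is natural under local diffeomorphisms. -/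
theorem localCurvature_pullback [FiniteDimensional ℝ F]
    (hG : ∀ᶠ y in 𝓝 (f z), IsMetricAt G y) (hf : ∀ᶠ x in 𝓝 z, IsImmersiveAt f x)
    (hs : ∀ᶠ x in 𝓝 z, Surjective (fderiv ℝ f x)) (u v w : F) :
    localCurvature G (f z) (fderiv ℝ f z u) (fderiv ℝ f z v) (fderiv ℝ f z w)
      = fderiv ℝ f z (localCurvature (pullbackMetric G f) z u v w) := by
  have humb : ∀ᶠ x in 𝓝 z, ∀ u v, localSecondFundamentalForm G f x u v
      = pullbackMetric G f x u v • (fun _ : F => (0 : E)) x := by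
    filter_upwards [hf.eventually_nhds, hs,
      hf.self_of_nhds.contDiffAt.continuousAt.eventually hG.eventually_nhds] with x h1 h2 h3 u v
    rw [smul_zero, localSecondFundamentalForm_eq_zero h3 h1 h2]
  have := localCurvature_of_umbilical hG hf (by fun_prop) humb u v w
  have h0 : ∀ u, covAlong G f (fun _ : F => (0 : E)) z u = 0 := fun u => by simp [covAlong]
  simpa [h0] using this

end Immersion

/-! ### Naturality of the second fundamental form; Schur's lemma -/

section Naturality

set_option maxSynthPendingDepth 3

variable {E F : Type*} [NormedAddCommGroup E] [NormedSpace ℝ E]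
  [NormedAddCommGroup F] [NormedSpace ℝ F]
  {G G' : E → E →L[ℝ] E →L[ℝ] ℝ}

theorem christoffelL_congr {y : E} (h : G =ᶠ[𝓝 y] G') : christoffelL G y = christoffelL G' y := by
  simp only [christoffelL, h.fderiv_eq, h.self_of_nhds]

theorem localCurvature_congr {y : E} (h : G =ᶠ[𝓝 y] G') (u v w : E) :
    localCurvature G y u v w = localCurvature G' y u v w := by
  have h1 : ∀ v w, (fun x => christoffel G x v w) =ᶠ[𝓝 y] fun x => christoffel G' x v w :=
    fun v w => h.eventually_nhds.mono fun x hx => by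
      simp only [christoffel_eq, christoffelL_congr hx]
  simp only [localCurvature, (h1 _ _).fderiv_eq]
  simp only [christoffel_eq, christoffelL_congr h]

theorem pullbackMetric_congr {f : F → E} {z : F} (hf : ContinuousAt f z)
    (h : G =ᶠ[𝓝 (f z)] G') : pullbackMetric G f =ᶠ[𝓝 z] pullbackMetric G' f :=
  (hf.eventually h).mono fun x hx => by simp only [pullbackMetric]; rw [hx]

theorem pullbackMetric_congr_map {f g : F → E} {z : F}
    (h : f =ᶠ[𝓝 z] g) : pullbackMetric G f =ᶠ[𝓝 z] pullbackMetric G g :=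
  h.eventuallyEq_nhds.mono fun x hx => by
    simp only [pullbackMetric, hx.fderiv_eq, hx.self_of_nhds]

theorem localSecondFundamentalForm_congr {f : F → E} {z : F} (hf : ContinuousAt f z)
    (h : G =ᶠ[𝓝 (f z)] G') (u v : F) :
    localSecondFundamentalForm G f z u v = localSecondFundamentalForm G' f z u v := by
  simp only [localSecondFundamentalForm, christoffel_eq, christoffelL_congr h,
    christoffelL_congr (pullbackMetric_congr hf h)]

theorem localSecondFundamentalForm_congr_map {f g : F → E} {z : F}
    (h : f =ᶠ[𝓝 z] g) (u v : F) :
    localSecondFundamentalForm G f z u v = localSecondFundamentalForm G g z u v := by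
  have h1 : (fun x => fderiv ℝ f x v) =ᶠ[𝓝 z] fun x => fderiv ℝ g x v :=
    h.eventuallyEq_nhds.mono fun x hx => by simp only [hx.fderiv_eq]
  simp only [localSecondFundamentalForm, christoffel_eq, h1.fderiv_eq, h.fderiv_eq, h.self_of_nhds,
    christoffelL_congr (pullbackMetric_congr_map h)]

theorem IsImmersiveAt.comp {D : Type*} [NormedAddCommGroup D] [NormedSpace ℝ D] {f : F → E}
    {s : D → F} {z : D} (hf : IsImmersiveAt f (s z)) (hs : IsImmersiveAt s z) :
    IsImmersiveAt (f ∘ s) z where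
  contDiffAt := hf.contDiffAt.comp z hs.contDiffAt
  injective := by
    rw [fderiv_comp z (hf.contDiffAt.differentiableAt (by simp))
      (hs.contDiffAt.differentiableAt (by simp))]
    exact hf.injective.comp hs.injective

theorem fderiv_fderiv_comp {D : Type*} [NormedAddCommGroup D] [NormedSpace ℝ D] {f : F → E}
    {s : D → F} {z : D} (hf : ∀ᶠ x in 𝓝 (s z), ContDiffAt ℝ ∞ f x)
    (hs : ∀ᶠ x in 𝓝 z, ContDiffAt ℝ ∞ s x) (u v : D) :
    fderiv ℝ (fderiv ℝ (f ∘ s)) z u v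
      = fderiv ℝ (fderiv ℝ f) (s z) (fderiv ℝ s z u) (fderiv ℝ s z v)
        + fderiv ℝ f (s z) (fderiv ℝ (fderiv ℝ s) z u v) := by
  have hsz := hs.self_of_nhds
  have hsd := hsz.differentiableAt (by simp)
  have hs' : DifferentiableAt ℝ (fderiv ℝ s) z :=
    (hsz.fderiv_right (m := ∞) (by simp)).differentiableAt (by simp)
  have hf' : DifferentiableAt ℝ (fderiv ℝ f) (s z) :=
    (hf.self_of_nhds.fderiv_right (m := ∞) (by simp)).differentiableAt (by simp)
  have e : fderiv ℝ (f ∘ s) =ᶠ[𝓝 z] fun x => (fderiv ℝ f (s x)).comp (fderiv ℝ s x) := by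
    filter_upwards [hs, hsz.continuousAt.eventually hf] with x h1 h2
    exact fderiv_comp x (h2.differentiableAt (by simp)) (h1.differentiableAt (by simp))
  have e2 : fderiv ℝ (fun x => fderiv ℝ f (s x)) z
      = (fderiv ℝ (fderiv ℝ f) (s z)).comp (fderiv ℝ s z) := fderiv_comp z hf' hsd
  have hc : DifferentiableAt ℝ (fun x => fderiv ℝ f (s x)) z := hf'.comp z hsd
  rw [e.fderiv_eq, fderiv_clm_comp hc hs', e2]
  simp [add_comm]

theorem pullbackMetric_comp {D : Type*} [NormedAddCommGroup D] [NormedSpace ℝ D] {f : F → E}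
    {s : D → F} {z : D} (hf : ∀ᶠ x in 𝓝 (s z), IsImmersiveAt f x)
    (hs : ∀ᶠ x in 𝓝 z, IsImmersiveAt s x) :
    pullbackMetric G (f ∘ s) =ᶠ[𝓝 z] pullbackMetric (pullbackMetric G f) s := by
  filter_upwards [hs, hs.self_of_nhds.contDiffAt.continuousAt.eventually hf] with x h1 h2
  ext u v
  simp only [pullbackMetric_apply]
  rw [fderiv_comp x (h2.contDiffAt.differentiableAt (by simp))
    (h1.contDiffAt.differentiableAt (by simp))]
  rfl

variable [FiniteDimensional ℝ E] [FiniteDimensional ℝ F]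

omit [FiniteDimensional ℝ E] in
/-- The second fundamental form does not depend on the parametrization of the submanifold. -/
theorem localSecondFundamentalForm_comp_right {f : F → E} {s : F → F} {z : F}
    (hG : ∀ᶠ y in 𝓝 (f (s z)), IsMetricAt G y) (hf : ∀ᶠ x in 𝓝 (s z), IsImmersiveAt f x)
    (hs : ∀ᶠ x in 𝓝 z, IsImmersiveAt s x) (u v : F) :
    localSecondFundamentalForm G (f ∘ s) z u v
      = localSecondFundamentalForm G f (s z) (fderiv ℝ s z u) (fderiv ℝ s z v) := by
  have hsz := hs.self_of_nhds
  have hfz := hf.self_of_nhds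
  have hh := eventually_isMetricAt_pullback hG hf
  have h0 := localSecondFundamentalForm_eq_zero hh hs
    (LinearMap.surjective_of_injective (f := (fderiv ℝ s z).toLinearMap) hsz.injective) u v
  rw [localSecondFundamentalForm_eq, sub_eq_zero, covAlong_fderiv_apply hsz.contDiffAt] at h0
  rw [localSecondFundamentalForm_eq, localSecondFundamentalForm_eq,
    christoffelL_congr (pullbackMetric_comp hf hs),
    covAlong_fderiv_apply (hfz.comp hsz).contDiffAt, covAlong_fderiv_apply hfz.contDiffAt,
    fderiv_fderiv_comp (hf.mono fun _ h => h.contDiffAt) (hs.mono fun _ h => h.contDiffAt),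
    fderiv_comp z (hfz.contDiffAt.differentiableAt (by simp))
    (hsz.contDiffAt.differentiableAt (by simp))]
  simp only [ContinuousLinearMap.comp_apply, ← h0, map_add, comp_apply]
  abel

omit [FiniteDimensional ℝ F] in
/-- The second fundamental form is natural under local isometries of the ambient space. -/
theorem localSecondFundamentalForm_comp_left {f : F → E} {t : E → E} {z : F}
    (hG : ∀ᶠ y in 𝓝 (t (f z)), IsMetricAt G y) (ht : ∀ᶠ x in 𝓝 (f z), IsImmersiveAt t x)
    (hf : ∀ᶠ x in 𝓝 z, IsImmersiveAt f x) (u v : F) :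
    localSecondFundamentalForm G (t ∘ f) z u v
      = fderiv ℝ t (f z) (localSecondFundamentalForm (pullbackMetric G t) f z u v) := by
  have hfz := hf.self_of_nhds
  have htz := ht.self_of_nhds
  have h0 := localSecondFundamentalForm_eq_zero hG ht
    (LinearMap.surjective_of_injective (f := (fderiv ℝ t (f z)).toLinearMap) htz.injective)
    (fderiv ℝ f z u) (fderiv ℝ f z v)
  rw [localSecondFundamentalForm_eq, sub_eq_zero, covAlong_fderiv_apply htz.contDiffAt] at h0
  rw [localSecondFundamentalForm_eq, localSecondFundamentalForm_eq,
    christoffelL_congr (pullbackMetric_comp ht hf),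
    covAlong_fderiv_apply (htz.comp hfz).contDiffAt, covAlong_fderiv_apply hfz.contDiffAt,
    fderiv_fderiv_comp (ht.mono fun _ h => h.contDiffAt) (hf.mono fun _ h => h.contDiffAt),
    fderiv_comp z (htz.contDiffAt.differentiableAt (by simp))
    (hfz.contDiffAt.differentiableAt (by simp))]
  simp only [ContinuousLinearMap.comp_apply, ← h0, map_add, map_sub, comp_apply]
  abel

/-- The Codazzi equation of a totally umbilical immersion. -/
theorem codazzi_of_umbilical [Nontrivial F] {f : F → E} {z : F}
    (hG : ∀ᶠ y in 𝓝 (f z), IsMetricAt G y) (hf : ∀ᶠ x in 𝓝 z, IsImmersiveAt f x)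
    (humb : ∀ᶠ x in 𝓝 z, ∃ H : E, ∀ u v,
      localSecondFundamentalForm G f x u v = pullbackMetric G f x u v • H)
    {u v w : F} (huw : pullbackMetric G f z u w = 0) (hvw : pullbackMetric G f z v w = 0)
    {ξ : E} (hξ : ∀ u, G (f z) (fderiv ℝ f z u) ξ = 0) :
    G (f z) (localCurvature G (f z) (fderiv ℝ f z u) (fderiv ℝ f z v) (fderiv ℝ f z w)) ξ = 0 := by
  obtain ⟨e, he⟩ := exists_ne (0 : F)
  have hh := eventually_isMetricAt_pullback hG hf
  have hfz := hf.self_of_nhds.contDiffAt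
  have hf' : ContDiffAt ℝ ∞ (fderiv ℝ f) z := hfz.fderiv_right (m := ∞) (by simp)
  have hf'd := hf'.differentiableAt (by simp)
  have hf''d : DifferentiableAt ℝ (fderiv ℝ (fderiv ℝ f)) z :=
    (hf'.fderiv_right (m := ∞) (by simp)).differentiableAt (by simp)
  have hhd : DifferentiableAt ℝ (pullbackMetric G f) z :=
    hh.self_of_nhds.contDiffAt.differentiableAt (by simp)
  have hΓh : DifferentiableAt ℝ (christoffelL (pullbackMetric G f)) z :=
    hh.self_of_nhds.contDiffAt_christoffelL.differentiableAt (by simp)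
  have hΓ : DifferentiableAt ℝ (fun x => christoffelL G (f x)) z :=
    (hG.self_of_nhds.contDiffAt_christoffelL.differentiableAt (by simp)).comp z
      (hfz.differentiableAt (by simp))
  have hB : DifferentiableAt ℝ (fun x => localSecondFundamentalForm G f x e e) z := by
    have : (fun x => localSecondFundamentalForm G f x e e) =ᶠ[𝓝 z] fun x =>
        fderiv ℝ (fderiv ℝ f) x e e + christoffelL G (f x) (fderiv ℝ f x e) (fderiv ℝ f x e)
          - fderiv ℝ f x (christoffelL (pullbackMetric G f) x e e) :=
      hf.mono fun x hx => by
        simp only [localSecondFundamentalForm_eq, covAlong_fderiv_apply hx.contDiffAt]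
    refine DifferentiableAt.congr_of_eventuallyEq ?_ this
    have hfe : DifferentiableAt ℝ (fun x => fderiv ℝ f x e) z := by fun_prop
    have h1 : DifferentiableAt ℝ (fun x => christoffelL (pullbackMetric G f) x e e) z := by
      fun_prop
    exact (DifferentiableAt.fun_add (by fun_prop) ((hΓ.clm_apply hfe).clm_apply hfe)).fun_sub
      (hf'd.clm_apply h1)
  -- the mean curvature field, recovered from one value of the second fundamental form
  let H : F → E := fun x =>
    (pullbackMetric G f x e e)⁻¹ • localSecondFundamentalForm G f x e e
  have hH : DifferentiableAt ℝ H z := by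
    have h1 : DifferentiableAt ℝ (fun x => pullbackMetric G f x e e) z := by fun_prop
    exact (h1.fun_inv (hh.self_of_nhds.pos e he).ne').fun_smul hB
  have humb' : ∀ᶠ x in 𝓝 z, ∀ u v,
      localSecondFundamentalForm G f x u v = pullbackMetric G f x u v • H x := by
    filter_upwards [humb, hh] with x ⟨K, hK⟩ hx u v
    simp only [H]
    rw [hK, hK, inv_smul_smul₀ (hx.pos e he).ne']
  rw [localCurvature_of_umbilical hG hf hH humb', huw, hvw]
  simp [hξ]

end Naturality

section Schur

set_option maxSynthPendingDepth 3

variable {E : Type*} [NormedAddCommGroup E] [NormedSpace ℝ E] [FiniteDimensional ℝ E]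
  {G : E → E →L[ℝ] E →L[ℝ] ℝ} {y : E} {a : E → ℝ}

omit [FiniteDimensional ℝ E] in
theorem covAlong_id (X : E → E) (x u : E) :
    covAlong G id X x u = fderiv ℝ X x u + christoffelL G x u (X x) := by simp [covAlong]

omit [FiniteDimensional ℝ E] in
theorem covAlong_const (u w x : E) :
    covAlong G id (fun _ => w) x u = christoffelL G x u w := by simp [covAlong]

/-- The second Bianchi identity, for coordinate fields `u, v, w` and the constant field `X`. -/
theorem localCurvature_second_bianchi (hG : ∀ᶠ x in 𝓝 y, IsMetricAt G x) (u v w X : E) :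
    (covAlong G id (fun x => localCurvature G x v w X) y u
        - localCurvature G y v w (christoffelL G y u X))
      + (covAlong G id (fun x => localCurvature G x w u X) y v
        - localCurvature G y w u (christoffelL G y v X))
      + (covAlong G id (fun x => localCurvature G x u v X) y w
        - localCurvature G y u v (christoffelL G y w X)) = 0 := by
  have hΓ : ∀ x, IsMetricAt G x → ∀ v,
      ContDiffAt ℝ ∞ (fun x => covAlong G id (fun _ => X) x v) x := by
    intro x hx v
    simp only [covAlong_const]
    have := hx.contDiffAt_christoffelL
    fun_prop
  have hcov : ∀ u v, ContDiffAt ℝ ∞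
      (fun x => covAlong G id (fun x => covAlong G id (fun _ => X) x v) x u) y := by
    intro u v
    have h0 := hG.self_of_nhds.contDiffAt_christoffelL
    have h1 := hΓ y hG.self_of_nhds v
    have h2 : ContDiffAt ℝ ∞ (fderiv ℝ (fun x => covAlong G id (fun _ => X) x v)) y :=
      h1.fderiv_right (m := ∞) (by simp)
    rw [funext fun x => covAlong_id (G := G) (fun x => covAlong G id (fun _ => X) x v) x u]
    exact (h2.clm_apply contDiffAt_const).add
      ((h0.clm_apply contDiffAt_const).clm_apply h1)
  have hd : ∀ u v, DifferentiableAt ℝ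
      (fun x => covAlong G id (fun x => covAlong G id (fun _ => X) x v) x u) y :=
    fun u v => (hcov u v).differentiableAt (by simp)
  have e : ∀ u v w, covAlong G id (fun x => localCurvature G x v w X) y u
      = covAlong G id (fun x => covAlong G id
          (fun x => covAlong G id (fun _ => X) x w) x v) y u
        - covAlong G id (fun x => covAlong G id
          (fun x => covAlong G id (fun _ => X) x v) x w) y u := by
    intro u v w
    rw [← covAlong_sub (hd v w) (hd w v)]
    refine covAlong_congr (hG.eventually_nhds.mono fun x hx => ?_) u
    have := covAlong_comm (f := id) (X := fun _ => X) hx (by fun_prop) (by fun_prop) v w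
    simpa using this.symm
  have e2 : ∀ u v w, localCurvature G y u v (christoffelL G y w X)
      = covAlong G id (fun x => covAlong G id
          (fun x => covAlong G id (fun _ => X) x w) x v) y u
        - covAlong G id (fun x => covAlong G id
          (fun x => covAlong G id (fun _ => X) x w) x u) y v := by
    intro u v w
    have := covAlong_comm (f := id) (X := fun x => covAlong G id (fun _ => X) x w) hG
      (by fun_prop) (hΓ y hG.self_of_nhds w) u v
    simpa [covAlong_const] using this.symm
  simp only [e, e2]
  abel

/-- Schur's lemma: pointwise constancy of the curvature, in dimension at least three, makes the
curvature function locally constant. -/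
theorem fderiv_eq_zero_of_curvature (hdim : 3 ≤ Module.finrank ℝ E)
    (hG : ∀ᶠ x in 𝓝 y, IsMetricAt G x) (ha : DifferentiableAt ℝ a y)
    (hR : ∀ᶠ x in 𝓝 y, ∀ u v w, localCurvature G x u v w = a x • (G x v w • u - G x u w • v)) :
    fderiv ℝ a y = 0 := by
  have hGy := hG.self_of_nhds
  have hGd := hGy.contDiffAt.differentiableAt (by simp)
  have hRy := hR.self_of_nhds
  -- the contribution of one cyclic position to the second Bianchi identity
  have e : ∀ u v w X, covAlong G id (fun x => localCurvature G x v w X) y u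
        - localCurvature G y v w (christoffelL G y u X)
      = fderiv ℝ a y u • (G y w X • v - G y v X • w)
        + a y • (G y (christoffelL G y u w) X • v + G y w X • christoffelL G y u v
          - G y (christoffelL G y u v) X • w - G y v X • christoffelL G y u w) := by
    intro u v w X
    have hGs : ∀ w, DifferentiableAt ℝ (fun x => G x w X) y := fun w => by fun_prop
    have c1 : (fun x => localCurvature G x v w X) =ᶠ[𝓝 y]
        fun x => a x • (G x w X • v - G x v X • w) := hR.mono fun x hx => hx v w X
    have d1 : ∀ w v : E, DifferentiableAt ℝ (fun x => G x w X • v) y :=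
      fun w v => (hGs w).smul_const v
    have e2 : ∀ w, fderiv ℝ (fun x => G x w X) y u = fderiv ℝ G y u w X := fun w => by
      rw [fderiv_clm_apply (by fun_prop) (by fun_prop), fderiv_clm_apply hGd (by fun_prop)]
      simp
    rw [covAlong_congr c1, covAlong_smul ha ((d1 w v).fun_sub (d1 v w)),
      covAlong_sub (d1 w v) (d1 v w), covAlong_smul (X := fun _ => v) (hGs w) (by fun_prop),
      covAlong_smul (X := fun _ => w) (hGs v) (by fun_prop), hRy, e2, e2, fderiv_metric hG,
      fderiv_metric hG]
    simp only [covAlong_const, add_smul, smul_add, smul_sub]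
    abel
  have key : ∀ u v w X, fderiv ℝ a y u • (G y w X • v - G y v X • w)
      + fderiv ℝ a y v • (G y u X • w - G y w X • u)
      + fderiv ℝ a y w • (G y v X • u - G y u X • v) = 0 := by
    intro u v w X
    have h := localCurvature_second_bianchi hG u v w X
    rw [e, e, e, christoffelL_symm hG u w, christoffelL_symm hG v u,
      christoffelL_symm hG w v] at h
    rw [← h]
    simp only [smul_add, smul_sub]
    abel
  have ex : ∀ u v : E, ∃ w, w ≠ 0 ∧ G y u w = 0 ∧ G y v w = 0 := by
    intro u v
    have := LinearMap.ker_ne_bot_of_finrank_lt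
      (f := ((G y u).toLinearMap.prod (G y v).toLinearMap)) (by simp; omega)
    obtain ⟨w, hw, hne⟩ := Submodule.exists_mem_ne_zero_of_ne_bot this
    simp at hw
    exact ⟨w, hne, hw.1, hw.2⟩
  -- for `v`, `w` orthogonal to `u` and to each other, `X = w` isolates `da(u) v` and `da(v) u`
  ext u
  obtain ⟨v, hv, huv, -⟩ := ex u u
  obtain ⟨w, hw, huw, hvw⟩ := ex u v
  have h := congrArg (fun t => G y t v) (key u v w w)
  have h1 := (hGy.pos v hv).ne'
  have h2 := (hGy.pos w hw).ne'
  simpa [huw, hvw, huv, h1, h2] using h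

/-- The curvature function is differentiable, being a quotient of smooth expressions in the metric;
no regularity of `a` is assumed. -/
theorem differentiableAt_of_curvature (hdim : 2 ≤ Module.finrank ℝ E)
    (hG : ∀ᶠ x in 𝓝 y, IsMetricAt G x)
    (hR : ∀ᶠ x in 𝓝 y, ∀ u v w, localCurvature G x u v w = a x • (G x v w • u - G x u w • v)) :
    DifferentiableAt ℝ a y := by
  have hGy := hG.self_of_nhds
  have hGd := hGy.contDiffAt.differentiableAt (by simp)
  have : Nontrivial E := Module.nontrivial_of_finrank_pos (R := ℝ) (by omega)
  obtain ⟨u, hu⟩ := exists_ne (0 : E)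
  obtain ⟨v, hv, huv⟩ : ∃ v, v ≠ 0 ∧ G y u v = 0 := by
    have := LinearMap.ker_ne_bot_of_finrank_lt (f := (G y u).toLinearMap) (by simp; omega)
    obtain ⟨w, hw, hne⟩ := Submodule.exists_mem_ne_zero_of_ne_bot this
    exact ⟨w, hne, by simpa using hw⟩
  have hΓ := hGy.contDiffAt_christoffelL
  have hΓd := hΓ.differentiableAt (by simp)
  have hΓ'd : DifferentiableAt ℝ (fderiv ℝ (christoffelL G)) y :=
    (hΓ.fderiv_right (m := ∞) (by simp)).differentiableAt (by simp)
  let q : E → ℝ := fun x => G x v v * G x u u - G x u v * G x v u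
  have hq : DifferentiableAt ℝ q y := by simp only [q]; fun_prop
  have hq0 : q y ≠ 0 := by
    simp only [q, huv, zero_mul, sub_zero]
    exact mul_ne_zero (hGy.pos v hv).ne' (hGy.pos u hu).ne'
  have hloc : DifferentiableAt ℝ (fun x => localCurvature G x u v v) y := by
    have e : (fun x => localCurvature G x u v v) =ᶠ[𝓝 y] _ :=
      hG.mono fun x hx => localCurvature_eq hx u v v
    refine DifferentiableAt.congr_of_eventuallyEq ?_ e
    have h1 : ∀ u v, DifferentiableAt ℝ (fun x => christoffelL G x u v) y := fun u v => by fun_prop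
    have h2 : ∀ u, DifferentiableAt ℝ (fun x => christoffelL G x u) y := fun u => by fun_prop
    have h3 := (h2 u).clm_apply (h1 v v)
    have h4 := (h2 v).clm_apply (h1 u v)
    fun_prop
  have hn : DifferentiableAt ℝ (fun x => G x (localCurvature G x u v v) u) y :=
    (hGd.clm_apply hloc).clm_apply (by fun_prop)
  have hdiv : DifferentiableAt ℝ (fun x => G x (localCurvature G x u v v) u / q x) y := by
    simp only [div_eq_mul_inv]
    exact hn.fun_mul (hq.fun_inv hq0)
  refine hdiv.congr_of_eventuallyEq ?_
  filter_upwards [hR, hq.continuousAt.eventually_ne hq0] with x hx hne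
  rw [eq_div_iff hne, hx]
  simp only [q, map_smul, map_sub, smul_apply, sub_apply, smul_eq_mul]

end Schur

/-! ### Algebraic curvature tensors on a Hermitian vector space -/

section CurvatureAlgebra

variable {V : Type*} [AddCommGroup V] [Module ℝ V]

/-- An algebraic curvature tensor: a quadrilinear form with the symmetries of the Riemann tensor. -/
structure IsCurvatureLike (T : V → V → V → V → ℝ) : Prop where
  add_left : ∀ x x' y z w, T (x + x') y z w = T x y z w + T x' y z w
  smul_left : ∀ (t : ℝ) x y z w, T (t • x) y z w = t * T x y z w
  skew : ∀ x y z w, T x y z w = -T y x z w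
  pair : ∀ x y z w, T x y z w = T z w x y
  bianchi : ∀ x y z w, T x y z w + T y z x w + T z x y w = 0

/-- The pair symmetry follows from the other symmetries of the Riemann tensor. -/
theorem IsCurvatureLike.of_skew_skew {T : V → V → V → V → ℝ}
    (add_left : ∀ x x' y z w, T (x + x') y z w = T x y z w + T x' y z w)
    (smul_left : ∀ (t : ℝ) x y z w, T (t • x) y z w = t * T x y z w)
    (skew : ∀ x y z w, T x y z w = -T y x z w)
    (skew' : ∀ x y z w, T x y z w = -T x y w z)
    (bianchi : ∀ x y z w, T x y z w + T y z x w + T z x y w = 0) : IsCurvatureLike T where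
  add_left := add_left
  smul_left := smul_left
  skew := skew
  pair x y z w := by
    linarith [bianchi x y z w, bianchi y z w x, bianchi z w x y, bianchi w x y z,
      skew' x y z w, skew' y z x w, skew' z x y w, skew' y z w x, skew' z w y x, skew' w y z x,
      skew' z w x y, skew' w x z y, skew' x z w y, skew' w x y z, skew' x y w z, skew' y w x z,
      skew y z x w, skew z x y w, skew x y z w, skew z w x y, skew w y z x, skew x z w y,
      skew w x y z, skew y w x z, skew w x z y, skew z w y x, skew y z w x]
  bianchi := bianchi

variable {g : V →ₗ[ℝ] V →ₗ[ℝ] ℝ} {J : V →ₗ[ℝ] V}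

/-- `g` is an inner product and `J` an orthogonal complex structure. -/
structure IsHermitianPair (g : V →ₗ[ℝ] V →ₗ[ℝ] ℝ) (J : V →ₗ[ℝ] V) : Prop where
  symm : ∀ x y, g x y = g y x
  pos : ∀ x, x ≠ 0 → 0 < g x x
  J_J : ∀ x, J (J x) = -x
  g_J_J : ∀ x y, g (J x) (J y) = g x y

theorem IsHermitianPair.g_J_left (h : IsHermitianPair g J) (x y : V) : g (J x) y = -g x (J y) := by
  have := h.g_J_J x (J y)
  rw [h.J_J, map_neg] at this
  linarith

theorem IsHermitianPair.g_J_self (h : IsHermitianPair g J) (x : V) : g (J x) x = 0 := by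
  linarith [h.g_J_left x x, h.symm x (J x)]

theorem IsHermitianPair.g_self_J (h : IsHermitianPair g J) (x : V) : g x (J x) = 0 := by
  rw [h.symm, h.g_J_self]

/-- A nonzero vector can be rescaled to any prescribed positive length. -/
theorem IsHermitianPair.exists_smul (h : IsHermitianPair g J) {x z : V} (hx : x ≠ 0) (hz : z ≠ 0) :
    ∃ t : ℝ, t ≠ 0 ∧ g (t • z) (t • z) = g x x := by
  have h1 := h.pos x hx
  have h2 := h.pos z hz
  refine ⟨√(g x x / g z z), (Real.sqrt_pos.2 (div_pos h1 h2)).ne', ?_⟩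
  simp only [map_smul, LinearMap.smul_apply, smul_eq_mul, ← mul_assoc]
  rw [Real.mul_self_sqrt (div_pos h1 h2).le, div_mul_cancel₀ _ h2.ne']

namespace IsCurvatureLike

variable {T : V → V → V → V → ℝ}

theorem skew' (hT : IsCurvatureLike T) (x y z w : V) : T x y z w = -T x y w z := by
  rw [hT.pair, hT.skew, hT.pair]

theorem add₂ (hT : IsCurvatureLike T) (x y y' z w : V) :
    T x (y + y') z w = T x y z w + T x y' z w := by
  rw [hT.skew, hT.add_left, hT.skew x y, hT.skew x y']; ring

theorem add₃ (hT : IsCurvatureLike T) (x y z z' w : V) :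
    T x y (z + z') w = T x y z w + T x y z' w := by
  rw [hT.pair, hT.add_left, hT.pair x y z, hT.pair x y z']

theorem add₄ (hT : IsCurvatureLike T) (x y z w w' : V) :
    T x y z (w + w') = T x y z w + T x y z w' := by
  rw [hT.pair, hT.add₂, hT.pair x y z w, hT.pair x y z w']

theorem smul₂ (hT : IsCurvatureLike T) (t : ℝ) (x y z w : V) :
    T x (t • y) z w = t * T x y z w := by
  rw [hT.skew, hT.smul_left, hT.skew x y]; ring

theorem smul₃ (hT : IsCurvatureLike T) (t : ℝ) (x y z w : V) :
    T x y (t • z) w = t * T x y z w := by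
  rw [hT.pair, hT.smul_left, hT.pair x y z]

theorem smul₄ (hT : IsCurvatureLike T) (t : ℝ) (x y z w : V) :
    T x y z (t • w) = t * T x y z w := by
  rw [hT.pair, hT.smul₂, hT.pair x y z w]

theorem neg₂ (hT : IsCurvatureLike T) (x y z w : V) : T x (-y) z w = -T x y z w := by
  rw [← neg_one_smul ℝ y, hT.smul₂]; ring

theorem neg₃ (hT : IsCurvatureLike T) (x y z w : V) : T x y (-z) w = -T x y z w := by
  rw [← neg_one_smul ℝ z, hT.smul₃]; ring

theorem neg₄ (hT : IsCurvatureLike T) (x y z w : V) : T x y z (-w) = -T x y z w := by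
  rw [← neg_one_smul ℝ w, hT.smul₄]; ring

theorem self (hT : IsCurvatureLike T) (x z w : V) : T x x z w = 0 := by
  linarith [hT.skew x x z w]

/-- An algebraic curvature tensor is determined by its sectional curvatures. -/
theorem eq_zero_of_sectional (hT : IsCurvatureLike T) (h : ∀ x y, T x y y x = 0) (x y z w : V) :
    T x y z w = 0 := by
  have h1 : ∀ x y z, T x y z x = 0 := by
    intro x y z
    have h0 := h x (y + z)
    rw [hT.add₂, hT.add₃, hT.add₃, h, h] at h0
    have := hT.pair x z y x
    linarith [hT.skew y x x z, hT.skew' x y x z]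
  have h2 : ∀ x y z w, T x y z w = T z x y w := by
    intro x y z w
    have h0 := h1 (x + w) y z
    rw [hT.add_left, hT.add₄, hT.add₄, h1, h1] at h0
    linarith [hT.skew w y z x, hT.pair y w z x]
  linarith [hT.bianchi x y z w, h2 x y z w, h2 z x y w]

section HermitianConditions

-- `hcod` is the Codazzi condition of coholomorphic planes, with normal vector `J f`; `hsec` says that
-- `T` vanishes on the planes spanned by `x, f` with `f` orthogonal to `x` and `J x`
variable (hT : IsCurvatureLike T) (h : IsHermitianPair g J)
  (hcod : ∀ x f, g x f = 0 → g (J x) f = 0 → ∀ X ∈ Submodule.span ℝ {x, J x, f},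
    ∀ Y ∈ Submodule.span ℝ {x, J x, f}, ∀ Z ∈ Submodule.span ℝ {x, J x, f},
    g X Z = 0 → g Y Z = 0 → T X Y Z (J f) = 0)
  (hsec : ∀ x f, g x f = 0 → g (J x) f = 0 → T x f f x = 0)

include hcod

/-- The Codazzi condition with `X = x`, `Y = J x`, `Z = f`. -/
theorem apply_J_J_self_J_eq_zero {x f : V} (h1 : g x f = 0) (h2 : g (J x) f = 0) :
    T x (J x) f (J f) = 0 :=
  hcod x f h1 h2 _ (Submodule.subset_span (by simp)) _ (Submodule.subset_span (by simp)) _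
    (Submodule.subset_span (by simp)) h1 h2

include h

/-- The Codazzi condition with `X = x`, `Y = f`, `Z = J x`. -/
theorem apply_J_J_eq_zero {x f : V} (h1 : g x f = 0) (h2 : g (J x) f = 0) :
    T x f (J x) (J f) = 0 :=
  hcod x f h1 h2 _ (Submodule.subset_span (by simp)) _ (Submodule.subset_span (by simp)) _
    (Submodule.subset_span (by simp)) (h.g_self_J x) (by rw [h.symm, h2])

include hT

/-- The Codazzi condition with `X = x + f`, `Y = J x`, `Z = f - x`. -/
theorem apply_J_eq_apply_J {x f : V} (h1 : g x f = 0) (h2 : g (J x) f = 0)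
    (hn : g x x = g f f) : T f (J x) f (J f) = T x (J x) x (J f) := by
  have hx : x ∈ Submodule.span ℝ {x, J x, f} := Submodule.subset_span (by simp)
  have hJx : J x ∈ Submodule.span ℝ {x, J x, f} := Submodule.subset_span (by simp)
  have hf : f ∈ Submodule.span ℝ {x, J x, f} := Submodule.subset_span (by simp)
  have e := hcod x f h1 h2 (x + f) (add_mem hx hf) (J x) hJx (f + -x) (add_mem hf (neg_mem hx))
    (by simp only [map_add, map_neg, LinearMap.add_apply, h1, h.symm f x, hn]; ring)
    (by simp only [map_add, map_neg, h2, h.g_J_self]; ring)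
  simp only [hT.add_left, hT.add₃, hT.neg₃] at e
  have e2 := hcod x f h1 h2 f hf (J x) hJx x hx (by rw [h.symm, h1]) (h.g_J_self x)
  have e3 := apply_J_J_self_J_eq_zero hcod h1 h2
  linarith

include hsec

/-- The holomorphic sectional curvatures of orthogonal holomorphic planes are opposite. -/
theorem holomorphic_add_eq_zero {a b : V} (h1 : g a b = 0) (h2 : g (J a) b = 0)
    (hn : g a a = g b b) : T a (J a) (J a) a + T b (J b) (J b) b = 0 := by
  have h3 : g a (J b) = 0 := by linarith [h.g_J_left a b]
  have h4 : g (J b) a = 0 := by rw [h.symm, h3]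
  have h5 : g b a = 0 := by rw [h.symm, h1]
  have h6 : g b (J a) = 0 := by rw [h.symm, h2]
  -- the plane of `a + b`, `J a - J b`; adding the cases `± b` removes the terms odd in `b`
  have key : ∀ s : ℝ, s * s = 1 →
      T (a + s • b) (J a + (-s) • J b) (J a + (-s) • J b) (a + s • b) = 0 := by
    intro s hs
    apply hsec
    · simp only [map_add, map_smul, LinearMap.add_apply, LinearMap.smul_apply, smul_eq_mul,
        h.g_self_J, h3, h6]; ring
    · simp only [map_add, map_smul, LinearMap.add_apply, LinearMap.smul_apply, smul_eq_mul,
        h.g_J_J, h1, h5, hn]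
      linear_combination (-g b b) * hs
  have e1 := key 1 (by norm_num)
  have e2 := key (-1) (by norm_num)
  simp only [hT.add_left, hT.add₂, hT.add₃, hT.add₄, hT.smul_left, hT.smul₂, hT.smul₃,
    hT.smul₄] at e1 e2
  have c1 := apply_J_J_self_J_eq_zero hcod h1 h2
  have c2 := apply_J_J_self_J_eq_zero hcod h5 h4
  have c3 := apply_J_J_eq_zero h hcod h3 (x := a) (f := J b) (by rw [h.g_J_J, h1])
  have c4 := apply_J_J_eq_zero h hcod h6 (x := b) (f := J a) (by rw [h.g_J_J, h5])
  rw [h.J_J, hT.neg₄] at c3 c4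
  have s1 := hsec a (J b) h3 (by rw [h.g_J_J, h1])
  have s2 := hsec b (J a) h6 (by rw [h.g_J_J, h5])
  linarith [hT.skew' a (J a) (J b) b, hT.skew' b (J b) (J a) a]

variable (hdim : ∀ x y, ∃ z, z ≠ 0 ∧ g x z = 0 ∧ g (J x) z = 0 ∧ g y z = 0 ∧ g (J y) z = 0)

include hdim

/-- Three pairwise orthogonal holomorphic planes force the holomorphic sectional curvature to
vanish. -/
theorem holomorphic_eq_zero (a : V) : T a (J a) (J a) a = 0 := by
  rcases eq_or_ne a 0 with rfl | ha
  · rw [map_zero, hT.self]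
  obtain ⟨b, hb, h1, h2, -, -⟩ := hdim a a
  obtain ⟨t, ht, hbn⟩ := h.exists_smul ha hb
  obtain ⟨c, hc, h3, h4, h5, h6⟩ := hdim a b
  obtain ⟨s, hs, hcn⟩ := h.exists_smul ha hc
  have e1 := holomorphic_add_eq_zero hT h hcod hsec (a := a) (b := t • b)
    (by simp [h1]) (by simp [h2]) hbn.symm
  have e2 := holomorphic_add_eq_zero hT h hcod hsec (a := a) (b := s • c)
    (by simp [h3]) (by simp [h4]) hcn.symm
  have e3 := holomorphic_add_eq_zero hT h hcod hsec (a := t • b) (b := s • c)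
    (by simp [h5]) (by simp [h6]) (hbn.trans hcn.symm)
  linarith

/-- With `A x f = T x (J x) f x`, the three relations `A f x = - A x f`, `A x (J f) = A f (J x)` and
`A x (J f) = A (J x) f` force `A x (J f) = 0`. -/
theorem apply_J_self_eq_zero_of_norm_eq {x f : V} (h1 : g x f = 0) (h2 : g (J x) f = 0)
    (hn : g x x = g f f) : T x (J x) (J f) x = 0 := by
  have h3 : g x (J f) = 0 := by linarith [h.g_J_left x f]
  -- exchanging the two vectors changes the sign: this is the coefficient of `t` in an identically
  -- vanishing quartic, extracted from its values at `t = ± 1, ± 2`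
  have hanti : ∀ x f, g x f = 0 → g (J x) f = 0 → g x x = g f f →
      T x (J x) f x + T f (J f) x f = 0 := by
    intro x f h1 h2 hn
    have h3 : g x (J f) = 0 := by linarith [h.g_J_left x f]
    have key : ∀ t : ℝ, T (x + t • J f) (f + t • J x) (f + t • J x) (x + t • J f) = 0 := by
      intro t
      apply hsec
      · simp only [map_add, map_smul, LinearMap.add_apply, LinearMap.smul_apply, smul_eq_mul,
          h.g_self_J, h.g_J_self, h.g_J_J, h1, h.symm f x]; ring
      · simp only [map_add, map_smul, LinearMap.add_apply, LinearMap.smul_apply, smul_eq_mul,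
          h.g_J_J, h.J_J, map_neg, LinearMap.neg_apply, h2, h.symm f (J x), hn]; ring
    have e1 := key 1
    have e2 := key (-1)
    have e3 := key 2
    have e4 := key (-2)
    simp only [hT.add_left, hT.add₂, hT.add₃, hT.add₄, hT.smul_left, hT.smul₂, hT.smul₃,
      hT.smul₄] at e1 e2 e3 e4
    linarith [hT.pair x f (J x) x, hT.skew' (J x) x x f, hT.skew x (J x) f x,
      hT.skew (J x) x f x, hT.pair x f f (J f), hT.pair x (J x) f x, hT.pair f (J f) x f,
      hT.pair (J f) f f x, hT.skew (J f) f f x, hT.skew' f (J f) f x]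
  have ha := hanti f (J x) (by rw [h.symm, h2]) (by rw [h.g_J_J, h.symm, h1])
    (by rw [h.g_J_J, hn])
  have hb := apply_J_eq_apply_J hT h hcod h1 h2 hn
  -- polarization of the vanishing of the holomorphic sectional curvature
  have hc : T f (J x) (J x) x + T x (J x) (J f) x = 0 := by
    have key : ∀ t : ℝ, T (x + t • f) (J x + t • J f) (J x + t • J f) (x + t • f) = 0 := by
      intro t
      have := holomorphic_eq_zero hT h hcod hsec hdim (x + t • f)
      simpa only [map_add, map_smul] using this
    have e1 := key 1
    have e2 := key (-1)
    have e3 := key 2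
    have e4 := key (-2)
    simp only [hT.add_left, hT.add₂, hT.add₃, hT.add₄, hT.smul_left, hT.smul₂, hT.smul₃,
      hT.smul₄] at e1 e2 e3 e4
    linarith [hT.pair f (J x) (J x) x, hT.skew (J x) x f (J x), hT.skew' x (J x) f (J x),
      hT.pair x (J x) (J f) x, hT.pair x (J f) (J x) x, hT.skew (J f) x x (J x),
      hT.skew' x (J f) x (J x), hT.pair x (J x) (J x) f, hT.skew (J x) x (J x) f,
      hT.pair x (J f) (J x) x, hT.skew' (J x) x x (J f), hT.skew x (J x) x (J f),
      hT.skew (J x) x (J f) x, hT.skew' x (J x) x (J f), hT.skew' (J x) f x (J x),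
      hT.skew (J x) f x (J x), hT.skew x (J x) (J x) f]
  rw [h.J_J] at ha
  simp only [hT.neg₂] at ha
  linarith [hT.pair f (J x) f (J f), hT.skew' f (J f) f (J x), hT.skew' x (J x) x (J f),
    hT.pair (J x) x f (J x), hT.skew' f (J x) (J x) x, hT.skew (J x) x f (J x),
    hT.pair x (J x) f (J x), hT.pair f (J x) x (J x)]

/-- An algebraic curvature tensor on a Hermitian vector space of complex dimension at least three
vanishes if it satisfies the Codazzi condition of umbilical coholomorphic subspaces and vanishes on
the planes spanned by `x, f` with `f` orthogonal to `x` and `J x`. -/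
theorem eq_zero_of_codazzi (x y z w : V) : T x y z w = 0 := by
  refine hT.eq_zero_of_sectional (fun x y => ?_) x y z w
  rcases eq_or_ne x 0 with rfl | hx
  · simpa using hT.smul_left 0 0 y y 0
  have hxx := (h.pos x hx).ne'
  obtain ⟨c, d, f, rfl, h1, h2⟩ : ∃ (c d : ℝ) (f : V), y = c • x + d • J x + f ∧ g x f = 0 ∧
      g (J x) f = 0 := by
    refine ⟨g x y / g x x, g (J x) y / g x x,
      y - (g x y / g x x) • x - (g (J x) y / g x x) • J x, by abel, ?_, ?_⟩
    · simp only [map_sub, map_smul, smul_eq_mul, h.g_self_J]; field_simp; ring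
    · simp only [map_sub, map_smul, smul_eq_mul, h.g_J_self, h.g_J_J]; field_simp; ring
  have hmix : T x (J x) f x = 0 := by
    rcases eq_or_ne f 0 with rfl | hf
    · rw [← zero_smul ℝ (0 : V), hT.smul₃, zero_mul]
    have hJf : J f ≠ 0 := fun h0 => hf (by simpa [h0] using (h.J_J f).symm)
    obtain ⟨t, ht, htn⟩ := h.exists_smul hx hJf
    have := apply_J_self_eq_zero_of_norm_eq hT h hcod hsec hdim (x := x) (f := t • J f)
      (by rw [map_smul, smul_eq_mul, ← neg_neg (g x (J f)), ← h.g_J_left, h2, neg_zero, mul_zero])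
      (by rw [map_smul, h.g_J_J, h1, smul_zero]) htn.symm
    rw [map_smul, h.J_J, hT.smul₃, hT.neg₃] at this
    simpa [ht] using this
  have hH := holomorphic_eq_zero hT h hcod hsec hdim x
  have hx0 : ∀ y, T x y x x = 0 := fun y => by rw [hT.pair, hT.self]
  have hmix' : T x f (J x) x = 0 := by
    rw [hT.pair, hT.skew, hT.skew', neg_neg, hmix]
  simp only [hT.add₂, hT.add₃, hT.smul₂, hT.smul₃, hH, hmix, hmix', hsec x f h1 h2, hT.self, hx0]
  ring

end HermitianConditions

end IsCurvatureLike

end CurvatureAlgebra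

/-! ### Coholomorphic planes and constant type -/

section CoholomorphicPlanes

variable {V : Type*} [AddCommGroup V] [Module ℝ V] {g : V →ₗ[ℝ] V →ₗ[ℝ] ℝ} {J : V →ₗ[ℝ] V}

theorem map_complex_structure_eq (hJ : ∀ x, J (J x) = -x) {σ : Submodule ℝ V}
    (hσ : ∀ s ∈ σ, J s ∈ σ) : σ.map J = σ := by
  refine le_antisymm (Submodule.map_le_iff_le_comap.2 hσ) fun s hs => ?_
  exact ⟨J (-s), hσ _ (neg_mem hs), by rw [hJ, neg_neg]⟩

variable [Module.Finite ℝ V]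

/-- Adjoining the complex line of a new vector to a complex subspace. -/
theorem exists_complex_extension (hJ : ∀ x, J (J x) = -x) {σ : Submodule ℝ V}
    (hσ : ∀ s ∈ σ, J s ∈ σ) {y : V} (hy : y ∉ σ) {W : Submodule ℝ V} (hσW : σ ≤ W) (hyW : y ∈ W)
    (hW : ∀ s ∈ W, J s ∈ W) :
    ∃ τ : Submodule ℝ V, σ ≤ τ ∧ τ ≤ W ∧ y ∈ τ ∧ (∀ s ∈ τ, J s ∈ τ) ∧
      Module.finrank ℝ τ = Module.finrank ℝ σ + 2 := by
  have hJy : J y ∉ σ ⊔ Submodule.span ℝ {y} := by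
    intro h
    obtain ⟨s, hs, z, hz, e⟩ := Submodule.mem_sup.1 h
    obtain ⟨c, rfl⟩ := Submodule.mem_span_singleton.1 hz
    -- `J y = s + c y` gives `(1 + c ^ 2) y ∈ σ`
    have h1 : (1 + c ^ 2) • y = -(J s + c • s) := by
      have h4 : -y = J s + (c • s + (c * c) • y) := by
        rw [← hJ y, ← e, map_add, map_smul, ← e, smul_add, smul_smul]
      rw [add_smul, one_smul, pow_two]
      linear_combination (norm := module) (-1 : ℝ) • h4
    have h3 : (1 + c ^ 2) • y ∈ σ := h1 ▸ neg_mem (add_mem (hσ s hs) (σ.smul_mem c hs))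
    exact hy ((σ.smul_mem_iff (by positivity)).1 h3)
  refine ⟨σ ⊔ Submodule.span ℝ {y} ⊔ Submodule.span ℝ {J y}, le_sup_of_le_left le_sup_left, ?_,
    Submodule.mem_sup_left (Submodule.mem_sup_right (Submodule.mem_span_singleton_self y)), ?_, ?_⟩
  · simpa [hσW, hyW] using hW y hyW
  · intro s hs
    obtain ⟨s', hs', z, hz, rfl⟩ := Submodule.mem_sup.1 hs
    obtain ⟨r, hr, w, hw, rfl⟩ := Submodule.mem_sup.1 hs'
    obtain ⟨c, rfl⟩ := Submodule.mem_span_singleton.1 hz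
    obtain ⟨d, rfl⟩ := Submodule.mem_span_singleton.1 hw
    rw [map_add, map_add, map_smul, map_smul, hJ]
    refine add_mem (add_mem ?_ ?_) ?_
    · exact Submodule.mem_sup_left (Submodule.mem_sup_left (hσ r hr))
    · exact Submodule.mem_sup_right (Submodule.smul_mem _ _ (Submodule.mem_span_singleton_self _))
    · exact Submodule.smul_mem _ _ (neg_mem (Submodule.mem_sup_left
        (Submodule.mem_sup_right (Submodule.mem_span_singleton_self _))))
  · rw [Submodule.finrank_sup_span_singleton hJy, Submodule.finrank_sup_span_singleton hy]

/-- A complex subspace contains, through each of its nonzero vectors, complex subspaces of every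
smaller dimension. -/
theorem exists_holomorphic_plane (hJ : ∀ x, J (J x) = -x) {W : Submodule ℝ V}
    (hW : ∀ s ∈ W, J s ∈ W) {x : V} (hx : x ≠ 0) (hxW : x ∈ W) {n : ℕ} (hn : 1 ≤ n)
    (hnW : 2 * n ≤ Module.finrank ℝ W) :
    ∃ σ ≤ W, x ∈ σ ∧ (∀ s ∈ σ, J s ∈ σ) ∧ Module.finrank ℝ σ = 2 * n := by
  induction n, hn using Nat.le_induction with
  | base =>
    obtain ⟨τ, -, h1, h2, h3, h4⟩ := exists_complex_extension hJ (σ := ⊥) (by simp)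
      (by simpa using hx) bot_le hxW hW
    exact ⟨τ, h1, h2, h3, by simpa using h4⟩
  | succ k hk ih =>
    obtain ⟨σ, h1, h2, h3, h4⟩ := ih (by omega)
    have hlt : σ < W := lt_of_le_of_ne h1 fun h => by rw [← h] at hnW; omega
    obtain ⟨y, hyW, hy⟩ := SetLike.exists_of_lt hlt
    obtain ⟨τ, t1, t2, -, t4, t5⟩ := exists_complex_extension hJ h3 hy h1 hyW hW
    exact ⟨τ, t2, t1 h2, t4, by omega⟩

theorem exists_ne_zero_orthogonal (g : V →ₗ[ℝ] V →ₗ[ℝ] ℝ) (J : V →ₗ[ℝ] V)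
    (hdim : 5 ≤ Module.finrank ℝ V) (x y : V) :
    ∃ z, z ≠ 0 ∧ g x z = 0 ∧ g (J x) z = 0 ∧ g y z = 0 ∧ g (J y) z = 0 := by
  have := LinearMap.ker_ne_bot_of_finrank_lt
    (f := (((g x).prod (g (J x))).prod ((g y).prod (g (J y))))) (by simp; omega)
  obtain ⟨w, hw, hne⟩ := Submodule.exists_mem_ne_zero_of_ne_bot this
  simp at hw
  exact ⟨w, hne, hw.1.1, hw.1.2, hw.2.1, hw.2.2⟩

/-- A coholomorphic plane containing `x`, `J x` and `f`, and orthogonal to `J f`. -/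
theorem exists_coholomorphic_plane (h : IsHermitianPair g J) {m n : ℕ} (hn : 1 ≤ n) (hnm : n < m)
    (hdim : Module.finrank ℝ V = 2 * m) {x f : V} (hx : x ≠ 0) (hf : f ≠ 0)
    (h1 : g x f = 0) (h2 : g (J x) f = 0) :
    ∃ π : Submodule ℝ V, Module.finrank ℝ π = 2 * n + 1 ∧
      (∃ σ ≤ π, Module.finrank ℝ σ = 2 * n ∧ σ.map J = σ) ∧
      Submodule.span ℝ {x, J x, f} ≤ π ∧ ∀ s ∈ π, g s (J f) = 0 := by
  let W : Submodule ℝ V := LinearMap.ker ((g f).prod (g (J f)))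
  have memW : ∀ s, s ∈ W ↔ g f s = 0 ∧ g (J f) s = 0 := fun s => by simp [W]
  have hWJ : ∀ s ∈ W, J s ∈ W := by
    intro s hs
    rw [memW] at hs ⊢
    rw [h.g_J_J, hs.1]
    exact ⟨by linarith [h.g_J_left f s], rfl⟩
  have hxW : x ∈ W := by
    rw [memW, h.symm f, h1, h.g_J_left, h.symm f, h2]; simp
  have hWdim : 2 * n ≤ Module.finrank ℝ W := by
    have e1 := LinearMap.finrank_range_add_finrank_ker ((g f).prod (g (J f)))
    have e2 := Submodule.finrank_le (LinearMap.range ((g f).prod (g (J f))))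
    rw [Module.finrank_prod, Module.finrank_self] at e2
    change _ + Module.finrank ℝ W = _ at e1
    omega
  obtain ⟨σ, s1, s2, s3, s4⟩ := exists_holomorphic_plane h.J_J hWJ hx hxW hn hWdim
  have hfσ : f ∉ σ := fun hfσ => (h.pos f hf).ne' ((memW f).1 (s1 hfσ)).1
  refine ⟨σ ⊔ Submodule.span ℝ {f}, ?_, ⟨σ, le_sup_left, s4, map_complex_structure_eq h.J_J s3⟩,
    ?_, ?_⟩
  · rw [Submodule.finrank_sup_span_singleton hfσ, s4]
  · rw [Submodule.span_le]
    rintro _ (rfl | rfl | rfl)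
    · exact Submodule.mem_sup_left s2
    · exact Submodule.mem_sup_left (s3 _ s2)
    · exact Submodule.mem_sup_right (Submodule.mem_span_singleton_self _)
  · intro s hs
    obtain ⟨r, hr, z, hz, rfl⟩ := Submodule.mem_sup.1 hs
    obtain ⟨c, rfl⟩ := Submodule.mem_span_singleton.1 hz
    rw [map_add, map_smul, LinearMap.add_apply, LinearMap.smul_apply, h.g_self_J, smul_zero,
      h.symm, ((memW r).1 (s1 hr)).2, add_zero]

/-- The algebraic core: the Codazzi condition on all coholomorphic `(2n+1)`-planes, together with
constant type, forces constant sectional curvature. -/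
theorem IsCurvatureLike.eq_of_constant_type {R : V → V → V → V → ℝ} (hR : IsCurvatureLike R)
    (h : IsHermitianPair g J) {m n : ℕ} (hm : 3 ≤ m) (hn : 1 ≤ n) (hnm : n < m)
    (hdim : Module.finrank ℝ V = 2 * m) {α : ℝ}
    (hcod : ∀ π : Submodule ℝ V, Module.finrank ℝ π = 2 * n + 1 →
      (∃ σ ≤ π, Module.finrank ℝ σ = 2 * n ∧ σ.map J = σ) →
      ∀ X ∈ π, ∀ Y ∈ π, ∀ Z ∈ π, g X Z = 0 → g Y Z = 0 →
      ∀ ξ, (∀ s ∈ π, g s ξ = 0) → R X Y Z ξ = 0)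
    (htype : ∀ X Y, g X Y = 0 → g (J X) Y = 0 → g Y Y = 1 →
      R X Y Y X - R X Y (J Y) (J X) = α * g X X) (x y z w : V) :
    R x y z w = α * (g y z * g x w - g x z * g y w) := by
  let T : V → V → V → V → ℝ := fun x y z w => R x y z w - α * (g y z * g x w - g x z * g y w)
  have hT : IsCurvatureLike T :=
    { add_left := fun x x' y z w => by
        simp only [T, hR.add_left, map_add, LinearMap.add_apply]; ring
      smul_left := fun t x y z w => by
        simp only [T, hR.smul_left, map_smul, LinearMap.smul_apply, smul_eq_mul]; ring
      skew := fun x y z w => by simp only [T]; rw [hR.skew]; ring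
      pair := fun x y z w => by
        simp only [T]
        rw [hR.pair, h.symm w x, h.symm z y, h.symm z x, h.symm w y]; ring
      bianchi := fun x y z w => by
        simp only [T]
        rw [h.symm z x, h.symm y x, h.symm z y]
        linear_combination hR.bianchi x y z w }
  have hcodT : ∀ x f, g x f = 0 → g (J x) f = 0 → ∀ X ∈ Submodule.span ℝ {x, J x, f},
      ∀ Y ∈ Submodule.span ℝ {x, J x, f}, ∀ Z ∈ Submodule.span ℝ {x, J x, f},
      g X Z = 0 → g Y Z = 0 → T X Y Z (J f) = 0 := by
    intro x f h1 h2 X hX Y hY Z hZ hXZ hYZ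
    rcases eq_or_ne f 0 with rfl | hf
    · rw [map_zero, ← zero_smul ℝ (0 : V), hT.smul₄, zero_mul]
    -- for `x = 0` any vector orthogonal to `f` and `J f` can take the place of `x`
    obtain ⟨x', hx', h1', h2', hspan⟩ : ∃ x', x' ≠ 0 ∧ g x' f = 0 ∧ g (J x') f = 0 ∧
        Submodule.span ℝ {x, J x, f} ≤ Submodule.span ℝ {x', J x', f} := by
      rcases eq_or_ne x 0 with rfl | hx
      · obtain ⟨z, hz, e1, e2, -, -⟩ := exists_ne_zero_orthogonal g J (by omega) f f
        refine ⟨z, hz, by rw [h.symm, e1], by rw [h.g_J_left, h.symm, e2, neg_zero], ?_⟩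
        rw [Submodule.span_le]
        rintro _ (rfl | rfl | rfl)
        · exact zero_mem _
        · rw [map_zero]; exact zero_mem _
        · exact Submodule.subset_span (by simp)
      · exact ⟨x, hx, h1, h2, le_rfl⟩
    obtain ⟨π, p1, p2, p3, p4⟩ := exists_coholomorphic_plane h hn hnm hdim hx' hf h1' h2'
    have := hcod π p1 p2 X (p3 (hspan hX)) Y (p3 (hspan hY)) Z (p3 (hspan hZ)) hXZ hYZ (J f) p4
    simp only [T, this, hXZ, hYZ]; ring
  have hsecT : ∀ x f, g x f = 0 → g (J x) f = 0 → T x f f x = 0 := by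
    intro x f h1 h2
    rcases eq_or_ne f 0 with rfl | hf
    · rw [← zero_smul ℝ (0 : V), hT.smul₂, zero_mul]
    have h0 := IsCurvatureLike.apply_J_J_eq_zero (T := T) h hcodT h1 h2
    have h4 : g x (J f) = 0 := by linarith [h.g_J_left x f]
    simp only [T, h.g_self_J, h4] at h0
    have hff := h.pos f hf
    have key := htype x ((√(g f f))⁻¹ • f) (by simp [h1]) (by simp [h2]) (by
      simp only [map_smul, LinearMap.smul_apply, smul_eq_mul, ← mul_assoc, ← mul_inv]
      rw [Real.mul_self_sqrt hff.le, inv_mul_cancel₀ hff.ne'])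
    simp only [map_smul, hR.smul₂, hR.smul₃, ← mul_assoc, ← mul_inv] at key
    rw [Real.mul_self_sqrt hff.le, ← mul_sub, inv_mul_eq_iff_eq_mul₀ hff.ne'] at key
    simp only [T, h1]
    linarith [hR.skew' x f (J x) (J f)]
  have := hT.eq_zero_of_codazzi h hcodT hsecT (exists_ne_zero_orthogonal g J (by omega)) x y z w
  simp only [T] at this
  linarith

end CoholomorphicPlanes

/-! ### The metric in charts -/

section Charts

variable {E : Type*} [NormedAddCommGroup E] [NormedSpace ℝ E]
  {M : Type*} [TopologicalSpace M] [ChartedSpace E M] [IsManifold 𝓘(ℝ, E) ∞ M]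
  {F : Type*} [NormedAddCommGroup F] [NormedSpace ℝ F]
  {N : Type*} [TopologicalSpace N] [ChartedSpace F N] [IsManifold 𝓘(ℝ, F) ∞ N]

/-- The representation of `f : N → M` in the preferred charts around `x` and `q`. -/
def inCharts (E : Type*) [NormedAddCommGroup E] [NormedSpace ℝ E] (F : Type*)
    [NormedAddCommGroup F] [NormedSpace ℝ F] {M : Type*} [TopologicalSpace M] [ChartedSpace E M]
    {N : Type*} [TopologicalSpace N] [ChartedSpace F N] (x : N) (q : M) (f : N → M) : F → E :=
  extChartAt 𝓘(ℝ, E) q ∘ f ∘ (extChartAt 𝓘(ℝ, F) x).symm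

theorem contMDiffAt_extChartAt_symm {x : N} {z : F} (hz : z ∈ (extChartAt 𝓘(ℝ, F) x).target) :
    ContMDiffAt 𝓘(ℝ, F) 𝓘(ℝ, F) ∞ (extChartAt 𝓘(ℝ, F) x).symm z :=
  (contMDiffOn_extChartAt_symm x).contMDiffAt ((isOpen_extChartAt_target x).mem_nhds hz)

theorem mfderiv_extChartAt_symm_injective {x : N} {z : F}
    (hz : z ∈ (extChartAt 𝓘(ℝ, F) x).target) :
    Injective (mfderiv 𝓘(ℝ, F) 𝓘(ℝ, F) (extChartAt 𝓘(ℝ, F) x).symm z) := by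
  have h := isInvertible_mfderivWithin_extChartAt_symm (I := 𝓘(ℝ, F)) hz
  rw [modelWithCornersSelf_coe, Set.range_id, mfderivWithin_univ] at h
  exact h.injective

theorem mfderiv_extChartAt_symm_self (x : N) (u : F) :
    mfderiv 𝓘(ℝ, F) 𝓘(ℝ, F) (extChartAt 𝓘(ℝ, F) x).symm (extChartAt 𝓘(ℝ, F) x x) u = u := by
  have h := mfderivWithin_range_extChartAt_symm (I := 𝓘(ℝ, F)) (x := x)
  rw [modelWithCornersSelf_coe, Set.range_id, mfderivWithin_univ] at h
  rw [h]
  rfl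

/-- The coordinate vector fields of a chart are smooth. -/
theorem contMDiffAt_coordinate_field {p : M} {y : E} (hy : y ∈ (extChartAt 𝓘(ℝ, E) p).target)
    (u : E) : ContMDiffAt 𝓘(ℝ, E) (𝓘(ℝ, E).prod 𝓘(ℝ, E)) ∞
      (fun y => Bundle.TotalSpace.mk' E (E := fun x : M => TangentSpace 𝓘(ℝ, E) x)
        ((extChartAt 𝓘(ℝ, E) p).symm y)
        (mfderiv 𝓘(ℝ, E) 𝓘(ℝ, E) (extChartAt 𝓘(ℝ, E) p).symm y u)) y := by
  have hopen := isOpen_extChartAt_target (I := 𝓘(ℝ, E)) p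
  have h1 := (contMDiffOn_extChartAt_symm (I := 𝓘(ℝ, E)) (n := ∞) p).contMDiffOn_tangentMapWithin
    (m := ∞) (by simp) hopen.uniqueMDiffOn
  have h2 : ContMDiffAt 𝓘(ℝ, E) (𝓘(ℝ, E).prod 𝓘(ℝ, E)) ∞
      (fun y : E => (⟨y, u⟩ : TangentBundle 𝓘(ℝ, E) E)) y :=
    contMDiffAt_vectorSpace_iff_contDiffAt.2 (contDiffAt_const (c := u))
  have h3 : (Bundle.TotalSpace.proj ⁻¹' (extChartAt 𝓘(ℝ, E) p).target :
      Set (TangentBundle 𝓘(ℝ, E) E)) ∈ 𝓝 (⟨y, u⟩ : TangentBundle 𝓘(ℝ, E) E) :=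
    (FiberBundle.continuous_proj E (TangentSpace 𝓘(ℝ, E) (M := E))).continuousAt.preimage_mem_nhds
      (hopen.mem_nhds hy)
  have h4 := (h1.contMDiffAt h3).comp y h2
  refine h4.congr_of_eventuallyEq ?_
  filter_upwards [hopen.mem_nhds hy] with z hz
  simp only [comp_apply, tangentMapWithin]
  rw [mfderivWithin_of_isOpen hopen hz]

variable {x : N} {q : M} {f : N → M} {z : F}

theorem contDiffAt_inCharts (hz : z ∈ (extChartAt 𝓘(ℝ, F) x).target)
    (hf : ContMDiffAt 𝓘(ℝ, F) 𝓘(ℝ, E) ∞ f ((extChartAt 𝓘(ℝ, F) x).symm z))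
    (hq : f ((extChartAt 𝓘(ℝ, F) x).symm z) ∈ (extChartAt 𝓘(ℝ, E) q).source) :
    ContDiffAt ℝ ∞ (inCharts E F x q f) z := by
  rw [← contMDiffAt_iff_contDiffAt]
  refine ContMDiffAt.comp z ?_ (hf.comp z (contMDiffAt_extChartAt_symm hz))
  exact contMDiffAt_extChartAt' (by rwa [extChartAt_source] at hq)

/-- The differential of `inCharts E F x q f` is the differential of `f` read in the charts. -/
theorem mfderiv_symm_fderiv_inCharts (hz : z ∈ (extChartAt 𝓘(ℝ, F) x).target)
    (hf : ContMDiffAt 𝓘(ℝ, F) 𝓘(ℝ, E) ∞ f ((extChartAt 𝓘(ℝ, F) x).symm z))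
    (hq : f ((extChartAt 𝓘(ℝ, F) x).symm z) ∈ (extChartAt 𝓘(ℝ, E) q).source) (u : F) :
    mfderiv 𝓘(ℝ, E) 𝓘(ℝ, E) (extChartAt 𝓘(ℝ, E) q).symm (inCharts E F x q f z)
        (fderiv ℝ (inCharts E F x q f) z u)
      = mfderiv 𝓘(ℝ, F) 𝓘(ℝ, E) f ((extChartAt 𝓘(ℝ, F) x).symm z)
          (mfderiv 𝓘(ℝ, F) 𝓘(ℝ, F) (extChartAt 𝓘(ℝ, F) x).symm z u) := by
  have hs := contMDiffAt_extChartAt_symm hz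
  have hfs := hf.comp z hs
  have htar : inCharts E F x q f z ∈ (extChartAt 𝓘(ℝ, E) q).target :=
    (extChartAt 𝓘(ℝ, E) q).map_source hq
  have e : (extChartAt 𝓘(ℝ, E) q).symm ∘ inCharts E F x q f
      =ᶠ[𝓝 z] f ∘ (extChartAt 𝓘(ℝ, F) x).symm := by
    have hn : (extChartAt 𝓘(ℝ, E) q).source ∈ 𝓝 ((f ∘ (extChartAt 𝓘(ℝ, F) x).symm) z) :=
      (isOpen_extChartAt_source q).mem_nhds hq
    filter_upwards [hfs.continuousAt.preimage_mem_nhds hn] with y hy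
    exact (extChartAt 𝓘(ℝ, E) q).left_inv hy
  have h1 := mfderiv_comp z ((contMDiffAt_extChartAt_symm htar).mdifferentiableAt (by simp))
    ((contDiffAt_inCharts hz hf hq).contMDiffAt.mdifferentiableAt (by simp))
  have h2 := mfderiv_comp z (hf.mdifferentiableAt (by simp)) (hs.mdifferentiableAt (by simp))
  rw [e.mfderiv_eq, h2, mfderiv_eq_fderiv] at h1
  exact (congrArg (fun L : F →L[ℝ] E => L u) h1).symm

theorem isImmersiveAt_inCharts (hz : z ∈ (extChartAt 𝓘(ℝ, F) x).target)
    (hf : ContMDiffAt 𝓘(ℝ, F) 𝓘(ℝ, E) ∞ f ((extChartAt 𝓘(ℝ, F) x).symm z))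
    (hq : f ((extChartAt 𝓘(ℝ, F) x).symm z) ∈ (extChartAt 𝓘(ℝ, E) q).source)
    (hinj : Injective (mfderiv 𝓘(ℝ, F) 𝓘(ℝ, E) f ((extChartAt 𝓘(ℝ, F) x).symm z))) :
    IsImmersiveAt (inCharts E F x q f) z where
  contDiffAt := contDiffAt_inCharts hz hf hq
  injective u v huv := by
    have hu := mfderiv_symm_fderiv_inCharts hz hf hq u
    have hv := mfderiv_symm_fderiv_inCharts hz hf hq v
    rw [huv, hv] at hu
    exact (mfderiv_extChartAt_symm_injective hz (hinj hu)).symm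

/-- The coordinate change from the preferred chart around `p` to the one around `q` is the case
`f = id` of `inCharts`. -/
theorem isImmersiveAt_transition {p q : M} {y : E} (hy : y ∈ (extChartAt 𝓘(ℝ, E) p).target)
    (hq : (extChartAt 𝓘(ℝ, E) p).symm y ∈ (extChartAt 𝓘(ℝ, E) q).source) :
    IsImmersiveAt (inCharts E E p q id) y :=
  isImmersiveAt_inCharts hy contMDiffAt_id hq (by rw [mfderiv_id]; exact injective_id)

theorem mfderiv_symm_fderiv_transition {p q : M} {y : E}
    (hy : y ∈ (extChartAt 𝓘(ℝ, E) p).target)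
    (hq : (extChartAt 𝓘(ℝ, E) p).symm y ∈ (extChartAt 𝓘(ℝ, E) q).source) (u : E) :
    mfderiv 𝓘(ℝ, E) 𝓘(ℝ, E) (extChartAt 𝓘(ℝ, E) q).symm (inCharts E E p q id y)
        (fderiv ℝ (inCharts E E p q id) y u)
      = mfderiv 𝓘(ℝ, E) 𝓘(ℝ, E) (extChartAt 𝓘(ℝ, E) p).symm y u := by
  have h := mfderiv_symm_fderiv_inCharts (f := id) hy contMDiffAt_id hq u
  rw [mfderiv_id] at h
  exact h

theorem eventually_mem_target_and_source {p q : M} {y : E}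
    (hy : y ∈ (extChartAt 𝓘(ℝ, E) p).target)
    (hq : (extChartAt 𝓘(ℝ, E) p).symm y ∈ (extChartAt 𝓘(ℝ, E) q).source) :
    ∀ᶠ z in 𝓝 y, z ∈ (extChartAt 𝓘(ℝ, E) p).target ∧
      (extChartAt 𝓘(ℝ, E) p).symm z ∈ (extChartAt 𝓘(ℝ, E) q).source :=
  ((isOpen_extChartAt_target p).eventually_mem hy).and
    ((contMDiffAt_extChartAt_symm hy).continuousAt.preimage_mem_nhds
      ((isOpen_extChartAt_source q).mem_nhds hq))

namespace AlmostHermitian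

variable (A : AlmostHermitian E M)

theorem chartMetric_apply (p : M) (y u v : E) :
    A.chartMetric p y u v = A.g.inner ((extChartAt 𝓘(ℝ, E) p).symm y)
      (mfderiv 𝓘(ℝ, E) 𝓘(ℝ, E) (extChartAt 𝓘(ℝ, E) p).symm y u)
      (mfderiv 𝓘(ℝ, E) 𝓘(ℝ, E) (extChartAt 𝓘(ℝ, E) p).symm y v) := rfl

/-- The preferred chart around `p` identifies `T_p M` with the model space. -/
theorem chartMetric_self (p : M) (u v : E) :
    A.chartMetric p (extChartAt 𝓘(ℝ, E) p p) u v = A.g.inner p u v := by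
  rw [chartMetric_apply, mfderiv_extChartAt_symm_self, mfderiv_extChartAt_symm_self]
  have : ∀ q : M, q = p → A.g.inner q u v = A.g.inner p u v := by rintro q rfl; rfl
  exact this _ (extChartAt_to_inv p)

theorem contDiffAt_chartMetric_apply {p : M} {y : E} (hy : y ∈ (extChartAt 𝓘(ℝ, E) p).target)
    (u v : E) : ContDiffAt ℝ ∞ (fun z => A.chartMetric p z u v) y := by
  have hb : ContMDiffAt 𝓘(ℝ, E) 𝓘(ℝ, E) ∞ (extChartAt 𝓘(ℝ, E) p).symm y :=
    contMDiffAt_extChartAt_symm hy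
  have hg : ContMDiffAt 𝓘(ℝ, E) (𝓘(ℝ, E).prod 𝓘(ℝ, E →L[ℝ] E →L[ℝ] ℝ)) ∞
      (fun y => Bundle.TotalSpace.mk' (E →L[ℝ] E →L[ℝ] ℝ)
        (E := fun x : M => TangentSpace 𝓘(ℝ, E) x →L[ℝ] TangentSpace 𝓘(ℝ, E) x →L[ℝ] ℝ)
        ((extChartAt 𝓘(ℝ, E) p).symm y) (A.g.inner ((extChartAt 𝓘(ℝ, E) p).symm y))) y :=
    ContMDiffAt.comp y A.g.contMDiff.contMDiffAt hb
  have hu := contMDiffAt_coordinate_field hy u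
  have hv := contMDiffAt_coordinate_field hy v
  have := ContMDiffAt.clm_bundle_apply₂ (F₁ := E) (F₂ := E) (F₃ := ℝ)
    (E₁ := fun x : M => TangentSpace 𝓘(ℝ, E) x) (E₂ := fun x : M => TangentSpace 𝓘(ℝ, E) x)
    (E₃ := Bundle.Trivial M ℝ) hg hu hv
  rw [Bundle.contMDiffAt_totalSpace] at this
  exact this.2.contDiffAt

theorem isMetricAt_chartMetric [FiniteDimensional ℝ E] {p : M} {y : E}
    (hy : y ∈ (extChartAt 𝓘(ℝ, E) p).target) : IsMetricAt (A.chartMetric p) y where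
  contDiffAt := by
    refine ContDiffAt.of_clm_apply fun u => ContDiffAt.of_clm_apply fun v => ?_
    exact A.contDiffAt_chartMetric_apply hy u v
  symm u v := by
    rw [chartMetric_apply, chartMetric_apply]
    exact A.g.symm _ _ _
  pos u hu := by
    rw [chartMetric_apply]
    refine A.g.pos _ _ fun h => hu ?_
    apply mfderiv_extChartAt_symm_injective hy
    exact h.trans
      (map_zero (mfderiv 𝓘(ℝ, E) 𝓘(ℝ, E) (extChartAt 𝓘(ℝ, E) p).symm y)).symm

/-- The local expression of the metric induced on `N` by `f : N → M`. -/
theorem pullbackMetric_inCharts (hz : z ∈ (extChartAt 𝓘(ℝ, F) x).target)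
    (hf : ContMDiffAt 𝓘(ℝ, F) 𝓘(ℝ, E) ∞ f ((extChartAt 𝓘(ℝ, F) x).symm z))
    (hq : f ((extChartAt 𝓘(ℝ, F) x).symm z) ∈ (extChartAt 𝓘(ℝ, E) q).source) (u v : F) :
    pullbackMetric (A.chartMetric q) (inCharts E F x q f) z u v
      = A.inducedInner F f ((extChartAt 𝓘(ℝ, F) x).symm z)
          (mfderiv 𝓘(ℝ, F) 𝓘(ℝ, F) (extChartAt 𝓘(ℝ, F) x).symm z u)
          (mfderiv 𝓘(ℝ, F) 𝓘(ℝ, F) (extChartAt 𝓘(ℝ, F) x).symm z v) := by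
  rw [pullbackMetric_apply, chartMetric_apply, mfderiv_symm_fderiv_inCharts hz hf hq,
    mfderiv_symm_fderiv_inCharts hz hf hq]
  have e : (extChartAt 𝓘(ℝ, E) q).symm (inCharts E F x q f z) = f ((extChartAt 𝓘(ℝ, F) x).symm z) :=
    (extChartAt 𝓘(ℝ, E) q).left_inv hq
  have : ∀ (r r' : M) (_ : r = r') (a b : E), A.g.inner r a b = A.g.inner r' a b := by
    rintro r r' rfl a b; rfl
  exact this _ _ e _ _

/-- The expressions of the metric in two charts differ by the coordinate change. -/
theorem pullbackMetric_transition {p q : M} {y : E} (hy : y ∈ (extChartAt 𝓘(ℝ, E) p).target)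
    (hq : (extChartAt 𝓘(ℝ, E) p).symm y ∈ (extChartAt 𝓘(ℝ, E) q).source) :
    pullbackMetric (A.chartMetric q) (inCharts E E p q id) =ᶠ[𝓝 y] A.chartMetric p := by
  filter_upwards [eventually_mem_target_and_source hy hq] with z ⟨hz, hzq⟩
  ext u v
  rw [A.pullbackMetric_inCharts (f := id) hz contMDiffAt_id hzq, inducedInner, mfderiv_id]
  rfl

end AlmostHermitian

end Charts

/-! ### Totally umbilical submanifolds in charts -/

section CurvatureTensor

set_option maxSynthPendingDepth 3

variable {E : Type*} [NormedAddCommGroup E] [NormedSpace ℝ E] [FiniteDimensional ℝ E]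
  {G : E → E →L[ℝ] E →L[ℝ] ℝ} {y₀ : E}

theorem isCurvatureLike_localCurvature (hG : ∀ᶠ z in 𝓝 y₀, IsMetricAt G z) :
    IsCurvatureLike fun u v w w' => G y₀ (localCurvature G y₀ u v w) w' := by
  have e := localCurvature_eq hG.self_of_nhds
  refine .of_skew_skew ?_ ?_ ?_ ?_ ?_
  · intro x x' y z w
    simp only [e, map_add, map_sub, add_apply, sub_apply]
    ring
  · intro t x y z w
    simp only [e, map_add, map_sub, map_smul, add_apply, sub_apply, smul_apply, smul_eq_mul]
    ring
  · intro x y z w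
    simp only [e, map_add, map_sub, add_apply, sub_apply]
    ring
  · intro x y z w
    have h1 := localCurvature_skew hG x y z w
    have h2 := hG.self_of_nhds.symm z (localCurvature G y₀ x y w)
    linarith
  · intro x y z w
    have h := congrArg (fun t => G y₀ t w) (localCurvature_bianchi hG x y z)
    simpa using h

end CurvatureTensor

namespace AlmostHermitian

variable {E : Type*} [NormedAddCommGroup E] [NormedSpace ℝ E] [FiniteDimensional ℝ E]
  {M : Type*} [TopologicalSpace M] [ChartedSpace E M] [IsManifold 𝓘(ℝ, E) ∞ M]
  (A : AlmostHermitian E M)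

theorem eventually_isMetricAt_chartMetric {p : M} {y : E}
    (hy : y ∈ (extChartAt 𝓘(ℝ, E) p).target) : ∀ᶠ z in 𝓝 y, IsMetricAt (A.chartMetric p) z :=
  ((isOpen_extChartAt_target p).eventually_mem hy).mono fun _ hz => A.isMetricAt_chartMetric hz

/-- `J` at `p`, as an endomorphism of the model space: the tangent space at `p` is identified with
it through the preferred chart. -/
def tangentJ (p : M) : E →ₗ[ℝ] E := (A.J p).toLinearMap

/-- The inner product on `T_p M`, read in the preferred chart around `p`, as a bilinear form on the
model space. -/
def tangentMetric (p : M) : E →ₗ[ℝ] E →ₗ[ℝ] ℝ :=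
  (A.chartMetric p (extChartAt 𝓘(ℝ, E) p p)).toLinearMap₁₂

omit [FiniteDimensional ℝ E] in
theorem tangentMetric_apply (p : M) (u v : E) : A.tangentMetric p u v = A.g.inner p u v :=
  A.chartMetric_self p u v

omit [FiniteDimensional ℝ E] in
theorem isHermitianPair (p : M) : IsHermitianPair (A.tangentMetric p) (A.tangentJ p) where
  symm x y := by rw [tangentMetric_apply, tangentMetric_apply]; exact A.g.symm p x y
  pos x hx := by rw [tangentMetric_apply]; exact A.g.pos p x hx
  J_J x := A.J_J p x
  g_J_J x y := by rw [tangentMetric_apply, tangentMetric_apply]; exact A.g_J_J p x y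

section Umbilical

variable {F : Type*} [NormedAddCommGroup F] [NormedSpace ℝ F] [FiniteDimensional ℝ F]
  {N : Type*} [TopologicalSpace N] [ChartedSpace F N] [IsManifold 𝓘(ℝ, F) ∞ N]
  {f : N → M} {x : N} {z : F}

/-- Umbilicity at a point near `x` is visible in the preferred charts around `x` and `f x`. -/
theorem IsTotallyUmbilical.inCharts (hf : A.IsTotallyUmbilical F f)
    (hz : z ∈ (extChartAt 𝓘(ℝ, F) x).target)
    (hp : f ((extChartAt 𝓘(ℝ, F) x).symm z) ∈ (extChartAt 𝓘(ℝ, E) (f x)).source) :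
    ∃ H : E, ∀ u v, localSecondFundamentalForm (A.chartMetric (f x)) (inCharts E F x (f x) f) z u v
      = pullbackMetric (A.chartMetric (f x)) (inCharts E F x (f x) f) z u v • H := by
  set x' := (extChartAt 𝓘(ℝ, F) x).symm z with hx'
  set F₁ := Coholomorphic.inCharts E F x' (f x') f with hF₁
  set σ := Coholomorphic.inCharts F F x x' id with hσ
  set τ := Coholomorphic.inCharts E E (f x') (f x) id with hτ
  have hxs : x' ∈ (extChartAt 𝓘(ℝ, F) x').source := mem_extChartAt_source x'
  have hσz : σ z = extChartAt 𝓘(ℝ, F) x' x' := rfl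
  have hsymm : (extChartAt 𝓘(ℝ, F) x').symm (σ z) = x' := by rw [hσz, extChartAt_to_inv]
  have hσt : σ z ∈ (extChartAt 𝓘(ℝ, F) x').target := mem_extChartAt_target x'
  have hcont : ContMDiff 𝓘(ℝ, F) 𝓘(ℝ, E) ∞ f := hf.contMDiff
  have hfx' : f x' ∈ (extChartAt 𝓘(ℝ, E) (f x')).source := mem_extChartAt_source _
  have hF₁z : F₁ (σ z) = extChartAt 𝓘(ℝ, E) (f x') (f x') := by
    simp only [hF₁, Coholomorphic.inCharts, comp_apply, hsymm]
  have hτt : F₁ (σ z) ∈ (extChartAt 𝓘(ℝ, E) (f x')).target := by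
    rw [hF₁z]; exact mem_extChartAt_target _
  have hτs : (extChartAt 𝓘(ℝ, E) (f x')).symm (F₁ (σ z)) ∈ (extChartAt 𝓘(ℝ, E) (f x)).source := by
    rw [hF₁z, extChartAt_to_inv]; exact hp
  -- near `z`, the expression of `f` in the charts around `x` is `τ ∘ F₁ ∘ σ`
  have hσimm : ∀ᶠ y in 𝓝 z, IsImmersiveAt σ y :=
    (eventually_mem_target_and_source hz hxs).mono fun y hy => isImmersiveAt_transition hy.1 hy.2
  have hτimm : ∀ᶠ y in 𝓝 (F₁ (σ z)), IsImmersiveAt τ y :=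
    (eventually_mem_target_and_source hτt hτs).mono fun y hy => isImmersiveAt_transition hy.1 hy.2
  have hnear : ∀ᶠ y in 𝓝 (σ z), y ∈ (extChartAt 𝓘(ℝ, F) x').target ∧
      f ((extChartAt 𝓘(ℝ, F) x').symm y) ∈ (extChartAt 𝓘(ℝ, E) (f x')).source := by
    refine ((isOpen_extChartAt_target x').eventually_mem hσt).and ?_
    have hc : ContinuousAt (f ∘ (extChartAt 𝓘(ℝ, F) x').symm) (σ z) :=
      (hcont.continuous.continuousAt).comp (contMDiffAt_extChartAt_symm hσt).continuousAt
    refine hc.preimage_mem_nhds ((isOpen_extChartAt_source (f x')).mem_nhds ?_)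
    simp only [comp_apply, hsymm]
    exact hfx'
  have hF₁imm : ∀ᶠ y in 𝓝 (σ z), IsImmersiveAt F₁ y :=
    hnear.mono fun y hy => isImmersiveAt_inCharts hy.1 (hcont _) hy.2 (hf.injective_mfderiv _)
  have hσc : ContinuousAt σ z := hσimm.self_of_nhds.contDiffAt.continuousAt
  have hfac : Coholomorphic.inCharts E F x (f x) f =ᶠ[𝓝 z] τ ∘ (F₁ ∘ σ) := by
    filter_upwards [eventually_mem_target_and_source hz hxs, hσc.eventually hnear] with y h1 h2
    have e1 : (extChartAt 𝓘(ℝ, F) x').symm (σ y) = (extChartAt 𝓘(ℝ, F) x).symm y :=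
      (extChartAt 𝓘(ℝ, F) x').left_inv h1.2
    have h3 := h2.2
    rw [e1] at h3
    have e2 : (extChartAt 𝓘(ℝ, E) (f x')).symm (F₁ (σ y))
        = f ((extChartAt 𝓘(ℝ, F) x).symm y) := by
      simp only [hF₁, Coholomorphic.inCharts, comp_apply, e1]
      exact (extChartAt 𝓘(ℝ, E) (f x')).left_inv h3
    simp only [hτ, Coholomorphic.inCharts, comp_apply, id]
    rw [e2]
  have hFσimm : ∀ᶠ y in 𝓝 z, IsImmersiveAt (F₁ ∘ σ) y := by
    filter_upwards [hσimm, hσc.eventually hF₁imm] with y h1 h2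
    exact h2.comp h1
  have hτz : τ (F₁ (σ z)) ∈ (extChartAt 𝓘(ℝ, E) (f x)).target :=
    (extChartAt 𝓘(ℝ, E) (f x)).map_source hτs
  refine ⟨fderiv ℝ τ (F₁ (σ z)) (A.meanCurvature F f x'), fun u v => ?_⟩
  have hu : ∀ u, fderiv ℝ σ z u
      = mfderiv 𝓘(ℝ, F) 𝓘(ℝ, F) (extChartAt 𝓘(ℝ, F) x).symm z u := by
    intro u
    rw [← mfderiv_symm_fderiv_transition hz hxs u]
    exact (mfderiv_extChartAt_symm_self x' _).symm
  rw [localSecondFundamentalForm_congr_map hfac,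
    localSecondFundamentalForm_comp_left (f := F₁ ∘ σ) (A.eventually_isMetricAt_chartMetric hτz)
      hτimm hFσimm,
    localSecondFundamentalForm_congr hFσimm.self_of_nhds.contDiffAt.continuousAt
      (A.pullbackMetric_transition hτt hτs),
    localSecondFundamentalForm_comp_right (A.eventually_isMetricAt_chartMetric hτt) hF₁imm hσimm,
    A.pullbackMetric_inCharts hz (hcont _) hp, ← hu, ← hu]
  have := hf.umbilical x' (fderiv ℝ σ z u) (fderiv ℝ σ z v)
  have h2 : localSecondFundamentalForm (A.chartMetric (f x')) F₁ (σ z) (fderiv ℝ σ z u)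
      (fderiv ℝ σ z v) = A.inducedInner F f x' (fderiv ℝ σ z u) (fderiv ℝ σ z v) •
        (A.meanCurvature F f x' : E) := this
  rw [h2]
  exact ContinuousLinearMap.map_smul (fderiv ℝ τ (F₁ (σ z))) _ _

/-- The Codazzi equation of a totally umbilical submanifold, on its tangent space. -/
theorem IsTotallyUmbilical.codazzi [Nontrivial F] (hf : A.IsTotallyUmbilical F f) (x : N)
    {X Y Z ξ : E}
    (hX : ∃ u : F, (mfderiv 𝓘(ℝ, F) 𝓘(ℝ, E) f x u : E) = X)
    (hY : ∃ u : F, (mfderiv 𝓘(ℝ, F) 𝓘(ℝ, E) f x u : E) = Y)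
    (hZ : ∃ u : F, (mfderiv 𝓘(ℝ, F) 𝓘(ℝ, E) f x u : E) = Z)
    (hξ : ∀ u : F, A.tangentMetric (f x) (mfderiv 𝓘(ℝ, F) 𝓘(ℝ, E) f x u) ξ = 0)
    (hXZ : A.tangentMetric (f x) X Z = 0) (hYZ : A.tangentMetric (f x) Y Z = 0) :
    A.tangentMetric (f x) (localCurvature (A.chartMetric (f x))
      (extChartAt 𝓘(ℝ, E) (f x) (f x)) X Y Z) ξ = 0 := by
  set z := extChartAt 𝓘(ℝ, F) x x with hzdef
  have hz : z ∈ (extChartAt 𝓘(ℝ, F) x).target := mem_extChartAt_target x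
  have hsymm : (extChartAt 𝓘(ℝ, F) x).symm z = x := extChartAt_to_inv x
  have hcont : ContMDiff 𝓘(ℝ, F) 𝓘(ℝ, E) ∞ f := hf.contMDiff
  have hp : f ((extChartAt 𝓘(ℝ, F) x).symm z) ∈ (extChartAt 𝓘(ℝ, E) (f x)).source := by
    rw [hsymm]; exact mem_extChartAt_source _
  set F₀ := Coholomorphic.inCharts E F x (f x) f with hF₀
  have hF₀z : F₀ z = extChartAt 𝓘(ℝ, E) (f x) (f x) := by
    simp only [hF₀, Coholomorphic.inCharts, comp_apply, hsymm]
  have hnear : ∀ᶠ y in 𝓝 z, y ∈ (extChartAt 𝓘(ℝ, F) x).target ∧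
      f ((extChartAt 𝓘(ℝ, F) x).symm y) ∈ (extChartAt 𝓘(ℝ, E) (f x)).source := by
    refine ((isOpen_extChartAt_target x).eventually_mem hz).and ?_
    have hc : ContinuousAt (f ∘ (extChartAt 𝓘(ℝ, F) x).symm) z :=
      (hcont.continuous.continuousAt).comp (contMDiffAt_extChartAt_symm hz).continuousAt
    exact hc.preimage_mem_nhds ((isOpen_extChartAt_source (f x)).mem_nhds hp)
  have hd : ∀ u : F, fderiv ℝ F₀ z u = mfderiv 𝓘(ℝ, F) 𝓘(ℝ, E) f x u := by
    intro u
    have h0 := ((hcont x).mdifferentiableAt (by simp)).mfderiv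
    simp only [modelWithCornersSelf_coe, Set.range_id, fderivWithin_univ] at h0
    exact (congrArg (fun L : F →L[ℝ] E => L u) h0).symm
  have hmem : F₀ z ∈ (extChartAt 𝓘(ℝ, E) (f x)).target := by
    rw [hF₀z]; exact mem_extChartAt_target _
  obtain ⟨u, rfl⟩ := hX
  obtain ⟨v, rfl⟩ := hY
  obtain ⟨w, rfl⟩ := hZ
  have hm : ∀ a b : E, A.tangentMetric (f x) a b = A.chartMetric (f x) (F₀ z) a b := by
    intro a b; rw [hF₀z]; rfl
  have key := codazzi_of_umbilical (f := F₀) (z := z) (u := u) (v := v) (w := w) (ξ := ξ)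
    (A.eventually_isMetricAt_chartMetric hmem)
    (hnear.mono fun y hy => isImmersiveAt_inCharts hy.1 (hcont _) hy.2 (hf.injective_mfderiv _))
    (hnear.mono fun y hy => IsTotallyUmbilical.inCharts A hf hy.1 hy.2)
    (by rw [pullbackMetric_apply, ← hm, hd, hd]; exact hXZ)
    (by rw [pullbackMetric_apply, ← hm, hd, hd]; exact hYZ)
    (fun u => by rw [← hm, hd]; exact hξ u)
  rw [← hm, hd, hd, hd, hF₀z] at key
  exact key

end Umbilical

end AlmostHermitian

/-! ### Curvature of a manifold satisfying the axiom of spheres -/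

namespace AlmostHermitian

variable {E : Type*} [NormedAddCommGroup E] [NormedSpace ℝ E] [FiniteDimensional ℝ E]
  {M : Type*} [TopologicalSpace M] [ChartedSpace E M] [IsManifold 𝓘(ℝ, E) ∞ M]
  (A : AlmostHermitian E M)

/-- The axiom of coholomorphic spheres gives the Codazzi condition on all coholomorphic planes. -/
theorem codazzi_of_spheres {n : ℕ} (hspheres : A.SatisfiesCoholomorphicSpheres n) (p : M)
    (π : Submodule ℝ E) (hdim : Module.finrank ℝ π = 2 * n + 1)
    (hσ : ∃ σ ≤ π, Module.finrank ℝ σ = 2 * n ∧ σ.map (A.tangentJ p) = σ)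
    {X Y Z ξ : E} (hX : X ∈ π) (hY : Y ∈ π) (hZ : Z ∈ π)
    (hXZ : A.tangentMetric p X Z = 0) (hYZ : A.tangentMetric p Y Z = 0)
    (hξ : ∀ s ∈ π, A.tangentMetric p s ξ = 0) :
    A.tangentMetric p (localCurvature (A.chartMetric p) (extChartAt 𝓘(ℝ, E) p p) X Y Z) ξ = 0 := by
  obtain ⟨N, _, _, _, f, x, hx, humb, hrange⟩ := hspheres p π ⟨hdim, hσ⟩
  subst hx
  subst hrange
  have : Nontrivial (Euc (2 * n + 1)) :=
    Module.nontrivial_of_finrank_pos (R := ℝ) (by rw [finrank_euclideanSpace_fin]; omega)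
  exact IsTotallyUmbilical.codazzi A humb x hX hY hZ (fun u => hξ _ ⟨u, rfl⟩) hXZ hYZ

/-- The curvature tensor at each point is that of a space of constant curvature `α p`. -/
theorem localCurvature_eq_of_spheres {m n : ℕ} (hm : 3 ≤ m) (hn : 1 ≤ n) (hnm : n < m)
    (hE : Module.finrank ℝ E = 2 * m) {α : M → ℝ} (htype : A.HasPointwiseConstantType α)
    (hspheres : A.SatisfiesCoholomorphicSpheres n) (p : M) (u v w : E) :
    localCurvature (A.chartMetric p) (extChartAt 𝓘(ℝ, E) p p) u v w
      = α p • (A.chartMetric p (extChartAt 𝓘(ℝ, E) p p) v w • u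
        - A.chartMetric p (extChartAt 𝓘(ℝ, E) p p) u w • v) := by
  have hG := A.eventually_isMetricAt_chartMetric (mem_extChartAt_target (I := 𝓘(ℝ, E)) p)
  refine hG.self_of_nhds.eq_of_forall fun w' => ?_
  have key := (isCurvatureLike_localCurvature hG).eq_of_constant_type (A.isHermitianPair p) hm hn
    hnm hE (α := α p)
    (fun π hdim hσ X hX Y hY Z hZ hXZ hYZ ξ hξ =>
      A.codazzi_of_spheres hspheres p π hdim hσ hX hY hZ hXZ hYZ hξ)
    (fun X Y h1 h2 h3 => by
      simp only [chartMetric_self]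
      rw [tangentMetric_apply] at h1 h2 h3 ⊢
      exact htype p X Y h1 h2 h3) u v w w'
  simp only [map_smul, map_sub, smul_apply, sub_apply, smul_eq_mul]
  exact key

theorem R_eq_of_spheres {m n : ℕ} (hm : 3 ≤ m) (hn : 1 ≤ n) (hnm : n < m)
    (hE : Module.finrank ℝ E = 2 * m) {α : M → ℝ} (htype : A.HasPointwiseConstantType α)
    (hspheres : A.SatisfiesCoholomorphicSpheres n) (p : M) (u v w w' : E) :
    A.R p u v w w' = α p * (A.g.inner p v w * A.g.inner p u w'
      - A.g.inner p u w * A.g.inner p v w') := by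
  have h := congrArg (fun t => A.tangentMetric p t w')
    (A.localCurvature_eq_of_spheres hm hn hnm hE htype hspheres p u v w)
  simp only [map_smul, map_sub, LinearMap.smul_apply, LinearMap.sub_apply, smul_eq_mul,
    tangentMetric_apply, chartMetric_self] at h
  exact h

/-- The curvature at all points of a chart domain, computed in that one chart. -/
theorem localCurvature_eq_in_chart {m n : ℕ} (hm : 3 ≤ m) (hn : 1 ≤ n) (hnm : n < m)
    (hE : Module.finrank ℝ E = 2 * m) {α : M → ℝ} (htype : A.HasPointwiseConstantType α)
    (hspheres : A.SatisfiesCoholomorphicSpheres n) {p : M} {y : E}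
    (hy : y ∈ (extChartAt 𝓘(ℝ, E) p).target) (u v w : E) :
    localCurvature (A.chartMetric p) y u v w
      = α ((extChartAt 𝓘(ℝ, E) p).symm y) •
        (A.chartMetric p y v w • u - A.chartMetric p y u w • v) := by
  set q := (extChartAt 𝓘(ℝ, E) p).symm y with hq
  have hqs : (extChartAt 𝓘(ℝ, E) p).symm y ∈ (extChartAt 𝓘(ℝ, E) q).source :=
    mem_extChartAt_source q
  set τ := inCharts E E p q id with hτ
  have hτy : τ y = extChartAt 𝓘(ℝ, E) q q := rfl
  have hG : ∀ᶠ z in 𝓝 (τ y), IsMetricAt (A.chartMetric q) z :=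
    A.eventually_isMetricAt_chartMetric (mem_extChartAt_target (I := 𝓘(ℝ, E)) q)
  have himm : ∀ᶠ z in 𝓝 y, IsImmersiveAt τ z :=
    (eventually_mem_target_and_source hy hqs).mono fun z hz => isImmersiveAt_transition hz.1 hz.2
  have hpull := A.pullbackMetric_transition hy hqs
  apply himm.self_of_nhds.injective
  have h1 := localCurvature_pullback hG himm (himm.mono fun z hz =>
    LinearMap.surjective_of_injective (f := (fderiv ℝ τ z).toLinearMap) hz.injective) u v w
  have h2 := A.localCurvature_eq_of_spheres hm hn hnm hE htype hspheres q
    (fderiv ℝ τ y u) (fderiv ℝ τ y v) (fderiv ℝ τ y w)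
  rw [localCurvature_congr hpull, hτy, h2, ← hτy, ← pullbackMetric_apply, ← pullbackMetric_apply,
    hpull.self_of_nhds] at h1
  rw [← h1, map_smul, map_sub, map_smul, map_smul]

/-- Schur's lemma on the manifold. -/
theorem isLocallyConstant_of_spheres {m n : ℕ} (hm : 3 ≤ m) (hn : 1 ≤ n) (hnm : n < m)
    (hE : Module.finrank ℝ E = 2 * m) {α : M → ℝ} (htype : A.HasPointwiseConstantType α)
    (hspheres : A.SatisfiesCoholomorphicSpheres n) : IsLocallyConstant α := by
  rw [IsLocallyConstant.iff_eventually_eq]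
  intro p
  have hopen := isOpen_extChartAt_target (I := 𝓘(ℝ, E)) p
  let a : E → ℝ := fun y => α ((extChartAt 𝓘(ℝ, E) p).symm y)
  have hR : ∀ y ∈ (extChartAt 𝓘(ℝ, E) p).target, ∀ᶠ x in 𝓝 y, ∀ u v w,
      localCurvature (A.chartMetric p) x u v w
        = a x • (A.chartMetric p x v w • u - A.chartMetric p x u w • v) := fun y hy =>
    (hopen.eventually_mem hy).mono fun z hz =>
      A.localCurvature_eq_in_chart hm hn hnm hE htype hspheres hz
  have hdiff : ∀ y ∈ (extChartAt 𝓘(ℝ, E) p).target, DifferentiableAt ℝ a y := fun y hy =>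
    differentiableAt_of_curvature (by omega) (A.eventually_isMetricAt_chartMetric hy) (hR y hy)
  have hzero : ∀ y ∈ (extChartAt 𝓘(ℝ, E) p).target, fderiv ℝ a y = 0 := fun y hy =>
    fderiv_eq_zero_of_curvature (by omega) (A.eventually_isMetricAt_chartMetric hy) (hdiff y hy)
      (hR y hy)
  obtain ⟨ε, hε, hball⟩ := Metric.isOpen_iff.1 hopen _ (mem_extChartAt_target p)
  have hconst : ∀ y ∈ Metric.ball (extChartAt 𝓘(ℝ, E) p p) ε,
      a y = a (extChartAt 𝓘(ℝ, E) p p) := fun y hy =>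
    Metric.isOpen_ball.is_const_of_fderiv_eq_zero (convex_ball _ _).isPreconnected
      (fun z hz => (hdiff z (hball hz)).differentiableWithinAt) (fun z hz => hzero z (hball hz)) hy
      (Metric.mem_ball_self hε)
  filter_upwards [(continuousAt_extChartAt (I := 𝓘(ℝ, E)) p).preimage_mem_nhds
      (Metric.ball_mem_nhds _ hε),
    extChartAt_source_mem_nhds (I := 𝓘(ℝ, E)) p] with q hq hqs
  have := hconst _ hq
  simp only [a] at this
  rwa [(extChartAt 𝓘(ℝ, E) p).left_inv hqs, extChartAt_to_inv] at this

end AlmostHermitian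

end Coholomorphic

end

theorem corollary3 {m n : ℕ} (hm : 3 ≤ m) (hn : 1 ≤ n) (hnm : n < m)
    {E : Type*} [NormedAddCommGroup E] [NormedSpace ℝ E] (hE : Module.finrank ℝ E = 2 * m)
    {M : Type*} [TopologicalSpace M] [ConnectedSpace M] [ChartedSpace E M]
    [IsManifold 𝓘(ℝ, E) ∞ M]
    (A : Coholomorphic.AlmostHermitian E M) (α : M → ℝ)
    (htype : A.HasPointwiseConstantType α)
    (hspheres : A.SatisfiesCoholomorphicSpheres n) :
    ∃ c : ℝ, (∀ p, α p = c) ∧ A.HasConstantCurvature c ∧ A.HasGlobalConstantType c := by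
  have : FiniteDimensional ℝ E := Module.finite_of_finrank_pos (by omega)
  obtain ⟨p₀⟩ := (inferInstance : Nonempty M)
  have hα : ∀ p, α p = α p₀ := fun p =>
    (A.isLocallyConstant_of_spheres hm hn hnm hE htype hspheres).apply_eq_of_preconnectedSpace p p₀
  refine ⟨α p₀, hα, fun p X Y hXY => ?_, fun p X Y h1 h2 h3 h4 => ?_⟩
  · have hcurv : A.R p X Y Y X = α p * (A.g.inner p X X * A.g.inner p Y Y
        - A.g.inner p X Y ^ 2) := by
      rw [A.R_eq_of_spheres hm hn hnm hE htype hspheres p X Y Y X, A.g.symm p Y X]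
      ring
    -- the Gram determinant of independent vectors does not vanish
    have hne : A.g.inner p X X * A.g.inner p Y Y - A.g.inner p X Y ^ 2 ≠ 0 := by
      have hX : X ≠ 0 := hXY.ne_zero 0
      have hXX := A.g.pos p X hX
      set Z := A.g.inner p X X • Y - A.g.inner p X Y • X with hZ
      have hZ0 : Z ≠ 0 := by
        intro h0
        have := LinearIndependent.pair_iff.1 hXY (-A.g.inner p X Y) (A.g.inner p X X) (by
          rw [← h0, hZ, neg_smul]; abel)
        exact hXX.ne' this.2
      have hZZ := A.g.pos p Z hZ0
      have e : A.g.inner p Z Z = A.g.inner p X X *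
          (A.g.inner p X X * A.g.inner p Y Y - A.g.inner p X Y ^ 2) := by
        simp only [hZ, map_sub, map_smul, sub_apply, smul_apply, smul_eq_mul]
        rw [A.g.symm p Y X]
        ring
      rw [e] at hZZ
      exact (pos_of_mul_pos_right hZZ hXX.le).ne'
    rw [Coholomorphic.AlmostHermitian.sectionalCurvature, hcurv, mul_div_cancel_right₀ _ hne, hα]
  · rw [htype p X Y h2 h1 h4, h3, mul_one, hα]
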